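/- **Setting.** Let $d\ge 1$, let $\mathcal X\subset\mathbb R^d$ be finite, and let $M=d(d+1)/2$. For $x\in\mathcal X$ let $\phi_x=\mathrm{vec}(xx^\top)G\in\mathbb R^M$, where $G\in\mathbb R^{d^2\times M}$ is the duplication matrix ($G\,\mathrm{vech}(A)=\mathrm{vec}(A)$ for symmetric $A$). Assume that $\{\phi_x:x\in\mathcal X\}$ spans $\mathbb R^M$ (so that $\mathcal X$ spans $\mathbb R^d$). Pulling arm $x$ returns $y=x^\top\theta^*+\eta$, where the noises of different pulls are independent and $\eta$ is centered and strictly sub-Gaussian with variance $\sigma_x^2=x^\top\Sigma^*x$, that is, $\mathbb E\,\eta=0$, $\mathbb E\,\eta^2=\sigma_x^2$ and $\mathbb E\,e^{s\eta}\le e^{s^2\sigma_x^2/2}$ for all $s\in\mathbb R$ (for example $\eta\sim\mathcal N(0,\sigma_x^2)$). Here $\theta^*\in\mathbb R^d$ and the positive semidefinite $\Sigma^*\in\mathbb R^{d\times d}$ are unknown, and $0<\sigma_{\min}^2\le\sigma_x^2\le\sigma_{\max}^2$ for all $x\in\mathcal X$ with known $\sigma_{\min}^2,\sigma_{\max}^2$;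 if $|\mathcal X|=1$, then $\sigma_{\min}^2=\sigma_{\max}^2$. **Designs.** For vectors $(v_x)_{x\in\mathcal X}$ and weights $w\ge 0$ with $A(w)=\sum_x w_xv_xv_x^\top$ nonsingular, put $g(w)=\max_x v_x^\top A(w)^{-1}v_x$. A G-optimal design is a probability vector on $\mathcal X$ that minimizes $g$ among those with $A(\cdot)$ nonsingular. Given a budget of $N$ pulls, a design $\lambda$ and a tolerance $\varepsilon\in(0,1/3]$, an efficient rounding of $N\lambda$ is a vector $n\in\mathbb N^{\mathcal X}$ with $\sum_x n_x\le N$, $A(n)$ nonsingular and $g(n)\le(1+6\varepsilon)\,g(N\lambda)$. **HEAD with budget $\Gamma\in\mathbb N$.** Stage 1: take a G-optimal design $\lambda^*$ for the vectors $x$; pull each arm $x$ either $\lceil\lambda^*_x\Gamma/2\rceil$ times or according to an efficient rounding of $\lambda^*\Gamma/2$; let $\widehat\theta=(\sum_t x_tx_t^\top)^{-1}\sum_t x_ty_t$ over these pulls. Stage 2: take a G-optimal design $\lambda^\dagger$ for the vectors $\phi_x$; make new pulls, implementing $\lambda^\dagger\Gamma/2$ in one of the same two ways; let $\mathrm{vech}(\widehat\Sigma)=(\sum_t\phi_{x_t}\phi_{x_t}^\top)^{-1}\sum_t\phi_{x_t}(y_t-x_t^\top\widehat\theta)^2$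 over the new pulls, with $\widehat\Sigma$ symmetric. Put $\widehat\sigma_x^2=\min\{\max\{x^\top\widehat\Sigma x,\sigma_{\min}^2\},\sigma_{\max}^2\}$. **Theorem.** There is a universal constant $C>0$ and, for every $\varepsilon\in(0,1/3]$, a constant $c>0$ depending only on $\varepsilon$, such that in the above setting, for all $\delta\in(0,1)$ and all $\Gamma\in\mathbb N$ with $$\Gamma\ \ge\ c\,\max\{\sigma_{\max}^2\log(|\mathcal X|/\delta)\,d^2,\ d^2\},$$ G-optimal designs $\lambda^*,\lambda^\dagger$ and efficient roundings of $\lambda^*\Gamma/2$ and $\lambda^\dagger\Gamma/2$ exist, and every run of HEAD (every admissible choice of designs and pull counts) satisfies $$\mathbb P\Big(\forall x\in\mathcal X:\ |\widehat\sigma_x^2-\sigma_x^2|\le C_{\Gamma,\delta}\Big)\ \ge\ 1-\delta/2,\qquad C_{\Gamma,\delta}=\sqrt{\frac{C\,\log(|\mathcal X|/\delta)\,\sigma_{\max}^4\,d^2}{\Gamma}} .$$ -/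

import Mathlib

open MeasureTheory ProbabilityTheory Matrix

noncomputable section

namespace HEAD

/-! ### Half-vectorization and the lifted features -/

/-- Positions `(i, j)` with `j ≤ i` of the lower triangular part of a `d × d` matrix;
there are `M = d (d + 1) / 2` of them. -/
abbrev HalfIdx (d : ℕ) : Type := {p : Fin d × Fin d // p.2 ≤ p.1}

/-- The position in the lower triangle that represents the (unordered) pair `i, j`. -/
def halfIdx {d : ℕ} (i j : Fin d) : HalfIdx d := ⟨(max i j, min i j), min_le_max⟩

/-- The half-vectorization of a matrix. -/
def vech {d : ℕ} (A : Matrix (Fin d) (Fin d) ℝ) : HalfIdx d → ℝ := fun p => A p.1.1 p.1.2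

/-- The symmetric matrix with a given half-vectorization. -/
def unvech {d : ℕ} (s : HalfIdx d → ℝ) : Matrix (Fin d) (Fin d) ℝ :=
  Matrix.of fun i j => s (halfIdx i j)

/-- The duplication matrix `G`. -/
def dupMatrix (d : ℕ) : Matrix (Fin d × Fin d) (HalfIdx d) ℝ :=
  Matrix.of fun q p => if p = halfIdx q.1 q.2 then 1 else 0

/-- The defining property of the duplication matrix: `G vech(A) = vec(A)` for symmetric `A`. -/
theorem dupMatrix_mulVec_vech {d : ℕ} (A : Matrix (Fin d) (Fin d) ℝ) (hA : A.IsSymm) :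
    dupMatrix d *ᵥ vech A = Matrix.vec A := by
  funext ⟨i, j⟩
  simp only [dupMatrix, mulVec, dotProduct, of_apply, vech, halfIdx, vec]
  rcases le_total i j with h | h
  · simp [h]
  · simp [h, hA.apply]

/-- The matrix `unvech s` is symmetric. -/
theorem unvech_isSymm {d : ℕ} (s : HalfIdx d → ℝ) : (unvech s).IsSymm := by
  ext i j
  simp [unvech, halfIdx, max_comm, min_comm]

/-- The half-vectorization of `unvech s` is `s`. -/
theorem vech_unvech {d : ℕ} (s : HalfIdx d → ℝ) : vech (unvech s) = s := by
  funext ⟨⟨i, j⟩, h⟩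
  have h' : j ≤ i := h
  simp [vech, unvech, halfIdx, h']

/-- The lifted feature `φ_x = vec(x xᵀ) G`. -/
def phi {d : ℕ} (x : Fin d → ℝ) : HalfIdx d → ℝ :=
  Matrix.vec (vecMulVec x x) ᵥ* dupMatrix d

/-! ### Experimental designs for a finite family of vectors `v i` -/

section Design

variable {ι κ : Type*} [Fintype ι] [Fintype κ] [DecidableEq κ]

/-- The information matrix `∑ i, w i • v i (v i)ᵀ` of a weighting `w`. -/
def infoMatrix (v : ι → κ → ℝ) (w : ι → ℝ) : Matrix κ κ ℝ :=
  ∑ i, w i • vecMulVec (v i) (v i)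

/-- The largest value over the family of `(v i)ᵀ (∑ j, w j • v j (v j)ᵀ)⁻¹ (v i)`. It is used only
for weightings with a nonsingular information matrix. -/
def maxPredVar (v : ι → κ → ℝ) (w : ι → ℝ) : ℝ :=
  ⨆ i, v i ⬝ᵥ ((infoMatrix v w)⁻¹ *ᵥ v i)

/-- `w` is a G-optimal design for the family `v`: a probability vector with nonsingular information
matrix that minimizes the largest predictive variance among all of these. (A singular information
matrix counts as predictive variance `+∞`.) -/
def IsGOptimal (v : ι → κ → ℝ) (w : ι → ℝ) : Prop :=
  w ∈ stdSimplex ℝ ι ∧ IsUnit (infoMatrix v w).det ∧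
    ∀ w' ∈ stdSimplex ℝ ι, IsUnit (infoMatrix v w').det → maxPredVar v w ≤ maxPredVar v w'

/-- The pull counts `n` are an efficient rounding, with tolerance `ε`, of the ideal allocation
`N • w`: at most `N` pulls, and the largest predictive variance is within a factor `1 + 6 ε` of that
of the ideal allocation. -/
def IsEfficientRounding (v : ι → κ → ℝ) (ε N : ℝ) (w : ι → ℝ) (n : ι → ℕ) : Prop :=
  (∑ i, (n i : ℝ)) ≤ N ∧ IsUnit (infoMatrix v fun i => (n i : ℝ)).det ∧
    maxPredVar v (fun i => (n i : ℝ)) ≤ (1 + 6 * ε) * maxPredVar v (fun i => N * w i)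

/-- Integer pull counts that implement the ideal allocation `N • w`: either every count is rounded
up, or the counts are an efficient rounding. -/
def IsAllocation (v : ι → κ → ℝ) (ε N : ℝ) (w : ι → ℝ) (n : ι → ℕ) : Prop :=
  (∀ i, n i = ⌈w i * N⌉₊) ∨ IsEfficientRounding v ε N w n

/-- The ordinary least squares estimate `(∑ t, f t (f t)ᵀ)⁻¹ (∑ t, y t • f t)`. -/
def leastSquares (f : ι → κ → ℝ) (y : ι → ℝ) : κ → ℝ :=
  (∑ t, vecMulVec (f t) (f t))⁻¹ *ᵥ ∑ t, y t • f t

end Design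

/-! ### The two-stage procedure -/

section Procedure

variable {d : ℕ}

/-- The variance `xᵀ S x` of the noise of arm `x`. -/
def armVar (S : Matrix (Fin d) (Fin d) ℝ) (x : Fin d → ℝ) : ℝ := x ⬝ᵥ (S *ᵥ x)

/-- The arms, as a family of vectors of `ℝ^d`. -/
def arms (X : Finset (Fin d → ℝ)) : X → Fin d → ℝ := fun x => x.1

/-- The lifted features of the arms, as a family of vectors of `ℝ^M`. -/
def features (X : Finset (Fin d → ℝ)) : X → HalfIdx d → ℝ := fun x => phi x.1

/-- The pulls of a stage in which arm `x` is pulled `n x` times. -/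
abbrev Pull {X : Finset (Fin d → ℝ)} (n : X → ℕ) : Type := Σ x : X, Fin (n x)

variable {X : Finset (Fin d → ℝ)} {n₁ n₂ : X → ℕ}

/-- The responses `y_t = x_tᵀ θ + η_t` of a stage. -/
def response {n : X → ℕ} (θ : Fin d → ℝ) (η : Pull n → ℝ) : Pull n → ℝ :=
  fun t => t.1.1 ⬝ᵥ θ + η t

/-- Stage 1: the least squares estimate of the mean parameter. -/
def thetaHat (y₁ : Pull n₁ → ℝ) : Fin d → ℝ :=
  leastSquares (fun t : Pull n₁ => t.1.1) y₁

/-- Stage 2: the estimate of the variance parameter, by least squares of the squared residuals of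
the second stage on the lifted features. -/
def sigmaHat (y₁ : Pull n₁ → ℝ) (y₂ : Pull n₂ → ℝ) : Matrix (Fin d) (Fin d) ℝ :=
  unvech (leastSquares (fun t : Pull n₂ => phi t.1.1)
    (fun t => (y₂ t - t.1.1 ⬝ᵥ thetaHat y₁) ^ 2))

/-- The variance estimate of arm `x`, clipped to `[σmin², σmax²]`. -/
def varHat (σmin σmax : ℝ) (y₁ : Pull n₁ → ℝ) (y₂ : Pull n₂ → ℝ) (x : Fin d → ℝ) : ℝ :=
  min (max (armVar (sigmaHat y₁ y₂) x) (σmin ^ 2)) (σmax ^ 2)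

end Procedure

/-- A centered random variable whose variance `v` is also a variance proxy for it (so `v` is its
optimal variance proxy). Centered Gaussian variables of variance `v` are examples. -/
def IsStrictlySubGaussian {Ω : Type*} [MeasurableSpace Ω] (Z : Ω → ℝ) (v : ℝ) (μ : Measure Ω) :
    Prop :=
  HasSubgaussianMGF Z v.toNNReal μ ∧ ∫ ω, Z ω ∂μ = 0 ∧ ∫ ω, Z ω ^ 2 ∂μ = v

end HEAD

end

/-! Write u for the first-stage error θ̂ − θ. A second-stage residual is η_t − x_t·u, and its square
is η_t² − 2(x_t·u)η_t + (x_t·u)². Since (x·u)² = φ_x · vech(uuᵀ), the squared bias is itself a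
linear response in the lifted features, so the second regression reproduces it exactly. With a_t the
least squares weights for arm x, the unclipped error is therefore ∑ a_t(η_t² − σ_t²) − 2∑
a_t(x_t·u)η_t + (x·u)² (`armVar_sigmaHat_sub`).

The designs control all the weights. By Kiefer–Wolfowitz the optimal value of a G-optimal design is
the dimension, which is at most d² in both stages, and either implementation with N = Γ/2 loses at
most a factor 3. Hence ∑ a_t² ≤ R and |a_t| ≤ R with R = 6d²/Γ, and the first-stage weights also
have sum of squares at most R.

Put l = log(|X|/δ) and V = σmax². When lR ≤ 1, the first term obeys a Bernstein bound of order
V√(lR). The bias obeys (x·u)² ≤ 10lVR for all arms. Given an accurate first stage, the cross term is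
a sub-Gaussian sum with frozen coefficients, of order lVR ≤ V√(lR). A union bound over arms and
terms finishes (`measureReal_two_stage_error_le`). When Γ is too small for this, the claimed radius
already exceeds the clipping interval.

Efficient roundings come from the lower barrier argument of Batson, Spielman and Srivastava
(`exists_barrier_step`, `exists_counts_ge`): after whitening, unit-weight vectors are added one at a
time while a lower bound on the spectrum rises at a fixed rate. -/

namespace HEAD

/-! ### G-optimal designs and the Kiefer–Wolfowitz theorem. -/

section DesignTheory

variable {ι κ : Type*} [Fintype ι]

theorem infoMatrix_smul (v : ι → κ → ℝ) (c : ℝ) (w : ι → ℝ) :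
    infoMatrix v (fun i => c * w i) = c • infoMatrix v w := by
  simp [infoMatrix, Finset.smul_sum, smul_smul]

variable [Fintype κ]

theorem infoMatrix_mulVec (v : ι → κ → ℝ) (w : ι → ℝ) (z : κ → ℝ) :
    infoMatrix v w *ᵥ z = ∑ i, (w i * (v i ⬝ᵥ z)) • v i := by
  simp only [infoMatrix, sum_mulVec, smul_mulVec, vecMulVec_mulVec]
  refine Finset.sum_congr rfl fun i _ => ?_
  simp [smul_smul]

theorem dotProduct_infoMatrix_mulVec (v : ι → κ → ℝ) (w : ι → ℝ) (z : κ → ℝ) :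
    z ⬝ᵥ (infoMatrix v w *ᵥ z) = ∑ i, w i * (v i ⬝ᵥ z) ^ 2 := by
  rw [infoMatrix_mulVec, dotProduct_sum]
  refine Finset.sum_congr rfl fun i _ => ?_
  rw [dotProduct_smul, dotProduct_comm z, smul_eq_mul]
  ring

theorem infoMatrix_posSemidef (v : ι → κ → ℝ) {w : ι → ℝ} (hw : ∀ i, 0 ≤ w i) :
    (infoMatrix v w).PosSemidef :=
  posSemidef_sum _ fun i _ => (posSemidef_vecMulVec_self_star (v i)).smul (hw i)

theorem infoMatrix_posDef_of_span {v : ι → κ → ℝ} (hv : ∀ u, (∀ i, v i ⬝ᵥ u = 0) → u = 0)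
    {w : ι → ℝ} (hw : ∀ i, 0 < w i) : (infoMatrix v w).PosDef := by
  refine .of_dotProduct_mulVec_pos (infoMatrix_posSemidef v fun i => (hw i).le).1 fun u hu => ?_
  rw [star_trivial, dotProduct_infoMatrix_mulVec]
  obtain ⟨i, hi⟩ : ∃ i, v i ⬝ᵥ u ≠ 0 := by
    by_contra! h
    exact hu (hv u h)
  have hi2 : 0 < (v i ⬝ᵥ u) ^ 2 := by positivity
  exact Finset.sum_pos' (fun j _ => mul_nonneg (hw j).le (sq_nonneg _))
    ⟨i, Finset.mem_univ i, mul_pos (hw i) hi2⟩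

variable [DecidableEq κ]

theorem infoMatrix_posDef_of_isUnit (v : ι → κ → ℝ) {w : ι → ℝ} (hw : ∀ i, 0 ≤ w i)
    (h : IsUnit (infoMatrix v w).det) : (infoMatrix v w).PosDef :=
  (infoMatrix_posSemidef v hw).posDef_iff_det_ne_zero.2 h.ne_zero

theorem isUnit_det_of_posDef {A : Matrix κ κ ℝ} (hA : A.PosDef) : IsUnit A.det :=
  hA.det_pos.ne'.isUnit

/-- A positive multiple of a Loewner lower bound on `B` bounds the inverse of `B` from above. -/
theorem dotProduct_inv_mulVec_le {A B : Matrix κ κ ℝ} (hA : A.PosDef) (hB : IsUnit B.det)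
    {l : ℝ} (hl : 0 < l) (h : ∀ z, l * (z ⬝ᵥ (A *ᵥ z)) ≤ z ⬝ᵥ (B *ᵥ z)) (v : κ → ℝ) :
    v ⬝ᵥ (B⁻¹ *ᵥ v) ≤ l⁻¹ * (v ⬝ᵥ (A⁻¹ *ᵥ v)) := by
  have hAu := isUnit_det_of_posDef hA
  set z := B⁻¹ *ᵥ v with hz
  have hBz : B *ᵥ z = v := by rw [hz, mulVec_mulVec, mul_nonsing_inv _ hB, one_mulVec]
  set y := A⁻¹ *ᵥ v with hy
  have hAy : A *ᵥ y = v := by rw [hy, mulVec_mulVec, mul_nonsing_inv _ hAu, one_mulVec]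
  have hAt : Aᵀ = A := by simpa using hA.isHermitian.eq
  have h1 := h z
  rw [hBz] at h1
  -- Completing the square: expanding the A-form at z − l⁻¹y and inserting zᵀAz ≤ l⁻¹ v·z leaves
  -- exactly v·z ≤ l⁻¹ v·y.
  have h2 := hA.posSemidef.dotProduct_mulVec_nonneg (z - l⁻¹ • y)
  have h3 : y ⬝ᵥ (A *ᵥ z) = v ⬝ᵥ z := by
    rw [dotProduct_mulVec, ← mulVec_transpose, hAt, hAy]
  simp only [star_trivial, mulVec_sub, mulVec_smul, hAy, dotProduct_sub, sub_dotProduct,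
    dotProduct_smul, smul_dotProduct, h3, smul_eq_mul] at h2
  rw [dotProduct_comm z v] at h1 h2
  rw [dotProduct_comm y v] at h2
  have h4 : z ⬝ᵥ (A *ᵥ z) ≤ l⁻¹ * (v ⬝ᵥ z) := by
    rw [inv_mul_eq_div, le_div_iff₀ hl, mul_comm]; exact h1
  have h5 : 0 ≤ l⁻¹ * (l⁻¹ * (v ⬝ᵥ y) - v ⬝ᵥ z) := by linarith
  have := nonneg_of_mul_nonneg_right h5 (inv_pos.2 hl)
  linarith

theorem dotProduct_inv_mulVec_nonneg {A : Matrix κ κ ℝ} (hA : A.PosDef) (v : κ → ℝ) :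
    0 ≤ v ⬝ᵥ (A⁻¹ *ᵥ v) := by
  simpa using hA.inv.posSemidef.dotProduct_mulVec_nonneg v

theorem le_maxPredVar (v : ι → κ → ℝ) (w : ι → ℝ) (i : ι) :
    v i ⬝ᵥ ((infoMatrix v w)⁻¹ *ᵥ v i) ≤ maxPredVar v w :=
  le_ciSup (f := fun i => v i ⬝ᵥ ((infoMatrix v w)⁻¹ *ᵥ v i)) (Set.finite_range _).bddAbove i

theorem maxPredVar_smul (v : ι → κ → ℝ) {w : ι → ℝ} (h : IsUnit (infoMatrix v w).det) {c : ℝ}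
    (hc : 0 < c) : maxPredVar v (fun i => c * w i) = c⁻¹ * maxPredVar v w := by
  have hcu : (infoMatrix v fun i => c * w i)⁻¹ = c⁻¹ • (infoMatrix v w)⁻¹ := by
    rw [infoMatrix_smul]
    exact inv_smul' (A := infoMatrix v w) (Units.mk0 c hc.ne') h
  simp only [maxPredVar, hcu, smul_mulVec, dotProduct_smul, smul_eq_mul]
  rw [Real.mul_iSup_of_nonneg (by positivity)]

/-- The average predictive variance under a design is the dimension. -/
theorem sum_mul_predVar (v : ι → κ → ℝ) {w : ι → ℝ} (h : IsUnit (infoMatrix v w).det) :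
    ∑ i, w i * (v i ⬝ᵥ ((infoMatrix v w)⁻¹ *ᵥ v i)) = Fintype.card κ := by
  have h1 : ((infoMatrix v w)⁻¹ * infoMatrix v w).trace = Fintype.card κ := by
    rw [nonsing_inv_mul _ h, trace_one]
  rw [← h1]
  conv_rhs => enter [1, 2]; rw [infoMatrix]
  rw [Finset.mul_sum, trace_sum]
  refine Finset.sum_congr rfl fun i _ => ?_
  rw [Matrix.mul_smul, trace_smul, mul_vecMulVec, trace_vecMulVec, dotProduct_comm, smul_eq_mul]

/-- A maximum dominates the weighted average. This is the lower half of Kiefer–Wolfowitz, valid for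
every design. -/
theorem card_le_maxPredVar (v : ι → κ → ℝ) {w : ι → ℝ} (hw : w ∈ stdSimplex ℝ ι)
    (h : IsUnit (infoMatrix v w).det) : (Fintype.card κ : ℝ) ≤ maxPredVar v w := by
  rw [← sum_mul_predVar v h]
  calc _ ≤ ∑ i, w i * maxPredVar v w :=
        Finset.sum_le_sum fun i _ => mul_le_mul_of_nonneg_left (le_maxPredVar v w i) (hw.1 i)
    _ = maxPredVar v w := by rw [← Finset.sum_mul, hw.2, one_mul]

theorem det_add_smul_vecMulVec {A : Matrix κ κ ℝ} (hA : IsUnit A.det) (s : ℝ) (u : κ → ℝ) :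
    (A + s • vecMulVec u u).det = A.det * (1 + s * (u ⬝ᵥ (A⁻¹ *ᵥ u))) := by
  have h := det_add_replicateCol_mul_replicateRow (ι := Unit) hA (s • u) u
  rw [← vecMulVec_eq, smul_vecMulVec] at h
  rw [h, det_unique (n := Unit), Matrix.mul_assoc, ← replicateCol_mulVec]
  simp [Matrix.mul_apply, dotProduct, mulVec_smul, Finset.mul_sum]

/-- Both sides agree at s = 0, so their right derivatives there are ordered. -/
theorem le_of_forall_one_add_mul_le_pow {a : ℝ} {m : ℕ}
    (h : ∀ s : ℝ, 0 ≤ s → 1 + s * a ≤ (1 + s) ^ m) : a ≤ m := by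
  by_contra! hlt
  have hd : HasDerivAt (fun s : ℝ => (1 + s) ^ m - (1 + s * a)) (m - a) 0 := by
    have h1 : HasDerivAt (fun s : ℝ => (1 + s) ^ m) (m : ℝ) 0 := by
      simpa using ((hasDerivAt_id (0 : ℝ)).const_add 1).fun_pow m
    have h2 : HasDerivAt (fun s : ℝ => 1 + s * a) a 0 := by
      simpa using ((hasDerivAt_id (0 : ℝ)).mul_const a).const_add 1
    exact h1.sub h2
  have hev := (hasDerivAt_iff_tendsto_slope.1 hd).eventually (gt_mem_nhds (sub_neg.2 hlt))
  have hev' : ∀ᶠ s in nhdsWithin (0 : ℝ) (Set.Ioi 0),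
      slope (fun s : ℝ => (1 + s) ^ m - (1 + s * a)) 0 s < 0 :=
    hev.filter_mono (nhdsWithin_mono _ fun s hs => (Set.mem_Ioi.1 hs).ne')
  obtain ⟨s, hs, hs0⟩ := (hev'.and self_mem_nhdsWithin).exists
  have hs0 : (0 : ℝ) < s := hs0
  simp only [slope_def_field, add_zero, one_pow, zero_mul, sub_self, sub_zero] at hs
  have := div_nonneg (sub_nonneg.2 (h s hs0.le)) hs0.le
  linarith

/-- **Kiefer–Wolfowitz**: some design has largest predictive variance at most the dimension. -/
theorem exists_maxPredVar_le_card [Nonempty ι] {v : ι → κ → ℝ}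
    (hv : ∀ u, (∀ i, v i ⬝ᵥ u = 0) → u = 0) :
    ∃ w ∈ stdSimplex ℝ ι, IsUnit (infoMatrix v w).det ∧ maxPredVar v w ≤ Fintype.card κ := by
  classical
  have hcont : Continuous fun w : ι → ℝ => (infoMatrix v w).det := by
    unfold infoMatrix
    refine Continuous.matrix_det (continuous_finsetSum _ fun i _ => ?_)
    exact (continuous_apply i).smul continuous_const
  have hu : (fun _ => (Fintype.card ι : ℝ)⁻¹ : ι → ℝ) ∈ stdSimplex ℝ ι :=
    ⟨fun _ => by positivity, by simp⟩
  obtain ⟨w, hw, hmax⟩ := (isCompact_stdSimplex ℝ ι).exists_isMaxOn ⟨_, hu⟩ hcont.continuousOn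
  have hpos : 0 < (infoMatrix v w).det :=
    (infoMatrix_posDef_of_span hv (w := fun _ => (Fintype.card ι : ℝ)⁻¹)
      fun _ => by positivity).det_pos.trans_le (hmax hu)
  refine ⟨w, hw, hpos.ne'.isUnit, ciSup_le fun i => ?_⟩
  -- The design w maximizes the determinant. With m the dimension and a the predictive variance at
  -- i, passing to (w + s·e_i)/(1 + s) multiplies the determinant by (1 + s)^(−m)(1 + s·a), which
  -- therefore cannot exceed 1.
  refine le_of_forall_one_add_mul_le_pow fun s hs => ?_
  have hs1 : 0 < 1 + s := by linarith
  have hmem : (fun j => (1 + s)⁻¹ * (w j + s * (if j = i then 1 else 0))) ∈ stdSimplex ℝ ι := by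
    refine ⟨fun j => ?_, ?_⟩
    · have := hw.1 j
      have : (0 : ℝ) ≤ if j = i then 1 else 0 := by split_ifs <;> norm_num
      positivity
    · rw [← Finset.mul_sum, Finset.sum_add_distrib, hw.2, ← Finset.mul_sum]
      simp [hs1.ne']
  have h1 : (infoMatrix v fun j => (1 + s)⁻¹ * (w j + s * if j = i then 1 else 0)).det ≤
      (infoMatrix v w).det := hmax hmem
  have h2 : infoMatrix v (fun j => w j + s * (if j = i then 1 else 0))
      = infoMatrix v w + s • vecMulVec (v i) (v i) := by
    simp only [infoMatrix, add_smul, Finset.sum_add_distrib, mul_smul]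
    congr 1
    rw [← Finset.smul_sum, Finset.sum_eq_single i] <;> simp +contextual
  rw [infoMatrix_smul, h2, det_smul, det_add_smul_vecMulVec hpos.ne'.isUnit, inv_pow,
    inv_mul_le_iff₀ (by positivity), mul_comm _ (infoMatrix v w).det] at h1
  exact le_of_mul_le_mul_left h1 hpos

theorem exists_isGOptimal [Nonempty ι] {v : ι → κ → ℝ}
    (hv : ∀ u, (∀ i, v i ⬝ᵥ u = 0) → u = 0) : ∃ w, IsGOptimal v w := by
  obtain ⟨w, hw, hu, hle⟩ := exists_maxPredVar_le_card hv
  exact ⟨w, hw, hu, fun w' hw' hu' => hle.trans (card_le_maxPredVar v hw' hu')⟩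

theorem IsGOptimal.maxPredVar_eq [Nonempty ι] {v : ι → κ → ℝ} {w : ι → ℝ} (h : IsGOptimal v w)
    (hv : ∀ u, (∀ i, v i ⬝ᵥ u = 0) → u = 0) : maxPredVar v w = Fintype.card κ := by
  obtain ⟨w', hw', hu', hle⟩ := exists_maxPredVar_le_card hv
  exact le_antisymm ((h.2.2 w' hw' hu').trans hle) (card_le_maxPredVar v h.1 h.2.1)

theorem IsGOptimal.posDef {v : ι → κ → ℝ} {w : ι → ℝ} (h : IsGOptimal v w) :
    (infoMatrix v w).PosDef :=
  infoMatrix_posDef_of_isUnit v h.1.1 h.2.1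

/-- Every implementation of a G-optimal design has predictive variances at most three times the
ideal value. -/
theorem IsAllocation.posDef_and_predVar_le [Nonempty ι] {v : ι → κ → ℝ} {w : ι → ℝ} {ε N : ℝ}
    {n : ι → ℕ} (hn : IsAllocation v ε N w n) (h : IsGOptimal v w)
    (hv : ∀ u, (∀ i, v i ⬝ᵥ u = 0) → u = 0) (hε : ε ≤ 1 / 3) (hN : 0 < N) :
    (infoMatrix v fun i => (n i : ℝ)).PosDef ∧
      ∀ i, v i ⬝ᵥ ((infoMatrix v fun i => (n i : ℝ))⁻¹ *ᵥ v i) ≤ 3 * Fintype.card κ / N := by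
  have hn0 : ∀ i, (0 : ℝ) ≤ n i := fun i => Nat.cast_nonneg _
  have hM : (0 : ℝ) ≤ Fintype.card κ := Nat.cast_nonneg _
  rcases hn with hn | ⟨-, hu, hle⟩
  -- Rounded-up counts dominate N·w, so here the loss factor is 1; for an efficient rounding it is 1
  -- + 6ε ≤ 3.
  · have key : ∀ z, N * (z ⬝ᵥ (infoMatrix v w *ᵥ z)) ≤
        z ⬝ᵥ (infoMatrix v (fun i => (n i : ℝ)) *ᵥ z) := fun z => by
      rw [dotProduct_infoMatrix_mulVec, dotProduct_infoMatrix_mulVec, Finset.mul_sum]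
      refine Finset.sum_le_sum fun i _ => ?_
      rw [← mul_assoc]
      refine mul_le_mul_of_nonneg_right ?_ (sq_nonneg _)
      rw [hn, mul_comm]
      exact Nat.le_ceil _
    have hpd : (infoMatrix v fun i => (n i : ℝ)).PosDef := by
      refine .of_dotProduct_mulVec_pos (infoMatrix_posSemidef v hn0).1 fun u hu => ?_
      have h1 := h.posDef.dotProduct_mulVec_pos hu
      rw [star_trivial] at *
      exact (mul_pos hN h1).trans_le (key u)
    refine ⟨hpd, fun i => ?_⟩
    refine (dotProduct_inv_mulVec_le h.posDef (isUnit_det_of_posDef hpd) hN key _).trans ?_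
    have h2 := le_maxPredVar v w i
    rw [h.maxPredVar_eq hv] at h2
    calc _ ≤ N⁻¹ * (Fintype.card κ : ℝ) := by gcongr
      _ ≤ _ := by rw [inv_mul_eq_div]; gcongr; linarith
  · refine ⟨infoMatrix_posDef_of_isUnit v hn0 hu, fun i => ?_⟩
    refine (le_maxPredVar v _ i).trans (hle.trans ?_)
    rw [maxPredVar_smul v h.2.1 hN, h.maxPredVar_eq hv, inv_mul_eq_div, mul_div_assoc]
    gcongr
    linarith

end DesignTheory

/-! ### Existence of efficient roundings by the lower barrier method. -/

section Rounding

variable {ι κ : Type*} [Fintype ι]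

theorem infoMatrix_add_single [DecidableEq ι] (u : ι → κ → ℝ) (n : ι → ℕ) (i : ι) :
    infoMatrix u (fun j => ((n + Pi.single i 1 : ι → ℕ) j : ℝ)) =
      infoMatrix u (fun j => (n j : ℝ)) + vecMulVec (u i) (u i) := by
  simp only [infoMatrix, Pi.add_apply, Nat.cast_add, add_smul, Finset.sum_add_distrib]
  congr 1
  rw [Finset.sum_eq_single i] <;> simp +contextual

variable [Fintype κ]

/-- Scalar form of the lower barrier step: some vector of a design that averages to the identity
compensates a shift `δ` of the spectrum `b`. -/
theorem exists_barrier_step {b : κ → ℝ} {p δ : ℝ} {w : ι → ℝ} {U : ι → κ → ℝ}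
    (hδ : 0 < δ) (hδp : δ * (1 + p) ≤ 1) (hb : ∀ k, δ < b k) (hp : ∑ k, (b k)⁻¹ ≤ p)
    (hw : w ∈ stdSimplex ℝ ι) (hU : ∀ i k, 0 ≤ U i k) (hsum : ∀ k, ∑ i, w i * U i k = 1) :
    ∃ i, ∑ k, (b k - δ)⁻¹ - (∑ k, U i k * (b k - δ)⁻¹ ^ 2) / (1 + ∑ k, U i k * (b k - δ)⁻¹)
      ≤ ∑ k, (b k)⁻¹ := by
  set β : κ → ℝ := fun k => (b k)⁻¹ with hβ
  set γ : κ → ℝ := fun k => (b k - δ)⁻¹ with hγ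
  have hb0 : ∀ k, 0 < b k := fun k => hδ.trans (hb k)
  have hβ0 : ∀ k, 0 < β k := fun k => inv_pos.2 (hb0 k)
  have hγ0 : ∀ k, 0 < γ k := fun k => inv_pos.2 (sub_pos.2 (hb k))
  have hβγ : ∀ k, γ k = β k + δ * (β k * γ k) := fun k => by
    have h1 := (hb0 k).ne'
    have h2 := (sub_pos.2 (hb k)).ne'
    simp only [hβ, hγ]
    field_simp
    ring
  set P := ∑ k, β k
  set T := ∑ k, β k * γ k with hT
  set R := ∑ k, β k * γ k ^ 2 with hR
  have hT0 : 0 ≤ T := Finset.sum_nonneg fun k _ => (mul_pos (hβ0 k) (hγ0 k)).le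
  have hR0 : 0 ≤ R := Finset.sum_nonneg fun k _ => (mul_pos (hβ0 k) (pow_pos (hγ0 k) 2)).le
  have hP0 : 0 ≤ P := Finset.sum_nonneg fun k _ => (hβ0 k).le
  have hD : ∑ k, γ k = P + δ * T := by
    rw [hT, Finset.mul_sum, ← Finset.sum_add_distrib]
    exact Finset.sum_congr rfl fun k _ => hβγ k
  have hS : ∑ k, γ k ^ 2 = T + δ * R := by
    rw [hT, hR, Finset.mul_sum, ← Finset.sum_add_distrib]
    refine Finset.sum_congr rfl fun k _ => ?_
    rw [pow_two]
    nth_rewrite 1 [hβγ k]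
    ring
  have hCS : T ^ 2 ≤ P * R :=
    Finset.sum_sq_le_sum_mul_sum_of_sq_le_mul _ (fun k _ => (hβ0 k).le)
      (fun k _ => (mul_pos (hβ0 k) (pow_pos (hγ0 k) 2)).le) fun k _ => le_of_eq (by ring)
  -- The shift raises the potential by ∑γ − ∑β = δT, and adding vector i lowers it by a quotient.
  -- This inequality says that numerator and denominator, averaged over w, have ratio at least δT;
  -- some i must then do as well. It follows from γ = β + δβγ, Cauchy–Schwarz and δ(1 + P) ≤ 1.
  have hmain : δ * T * (1 + ∑ k, γ k) ≤ ∑ k, γ k ^ 2 := by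
    rw [hD, hS]
    have h1 : δ * (1 + P) ≤ 1 := (mul_le_mul_of_nonneg_left (by linarith) hδ.le).trans hδp
    have h2 : T * (δ * (1 + P)) ≤ T * 1 := mul_le_mul_of_nonneg_left h1 hT0
    have h3 : δ ^ 2 * T ^ 2 ≤ δ ^ 2 * (P * R) := mul_le_mul_of_nonneg_left hCS (sq_nonneg δ)
    have h4 : δ * R * (δ * P) ≤ δ * R * 1 := mul_le_mul_of_nonneg_left (by linarith) (by positivity)
    nlinarith
  by_contra! hcon
  have hlt : ∀ i, 0 < δ * T * (1 + ∑ k, U i k * γ k) - ∑ k, U i k * γ k ^ 2 := fun i => by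
    have h1 : 0 < 1 + ∑ k, U i k * γ k :=
      add_pos_of_pos_of_nonneg one_pos
        (Finset.sum_nonneg fun k _ => mul_nonneg (hU i k) (hγ0 k).le)
    have h2 : (∑ k, U i k * γ k ^ 2) / (1 + ∑ k, U i k * γ k) < δ * T := by
      have := hcon i
      linarith [hD]
    rw [div_lt_iff₀ h1] at h2
    linarith
  obtain ⟨i₀, hi₀⟩ : ∃ i, 0 < w i := by
    by_contra! h
    have : ∑ i, w i ≤ 0 := Finset.sum_nonpos fun i _ => h i
    linarith [hw.2]
  have hpos : 0 < ∑ i, w i * (δ * T * (1 + ∑ k, U i k * γ k) - ∑ k, U i k * γ k ^ 2) :=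
    Finset.sum_pos' (fun i _ => mul_nonneg (hw.1 i) (hlt i).le)
      ⟨i₀, Finset.mem_univ _, mul_pos hi₀ (hlt i₀)⟩
  have havg : ∀ g : κ → ℝ, ∑ i, w i * ∑ k, U i k * g k = ∑ k, g k := fun g => by
    simp only [Finset.mul_sum]
    rw [Finset.sum_comm]
    refine Finset.sum_congr rfl fun k _ => ?_
    simp only [← mul_assoc]
    rw [← Finset.sum_mul, hsum, one_mul]
  have heq : ∑ i, w i * (δ * T * (1 + ∑ k, U i k * γ k) - ∑ k, U i k * γ k ^ 2)
      = δ * T * (1 + ∑ k, γ k) - ∑ k, γ k ^ 2 := by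
    have e : ∀ i, w i * (δ * T * (1 + ∑ k, U i k * γ k) - ∑ k, U i k * γ k ^ 2) =
        δ * T * w i + δ * T * (w i * ∑ k, U i k * γ k) - w i * ∑ k, U i k * γ k ^ 2 :=
      fun i => by ring
    rw [Finset.sum_congr rfl fun i _ => e i, Finset.sum_sub_distrib, Finset.sum_add_distrib,
      ← Finset.mul_sum, ← Finset.mul_sum, hw.2, havg γ, havg fun k => γ k ^ 2]
    ring
  linarith

variable [DecidableEq κ]

/-- Sherman–Morrison for a diagonal matrix, then the trace. -/
theorem trace_inv_diagonal_add_vecMulVec {c : κ → ℝ} (hc : ∀ k, 0 < c k) (u : κ → ℝ) :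
    (diagonal c + vecMulVec u u)⁻¹.trace =
      ∑ k, (c k)⁻¹ - (∑ k, u k ^ 2 * (c k)⁻¹ ^ 2) / (1 + ∑ k, u k ^ 2 * (c k)⁻¹) := by
  set a := ∑ k, u k ^ 2 * (c k)⁻¹ with ha
  have ha0 : 0 < 1 + a :=
    add_pos_of_pos_of_nonneg one_pos
      (Finset.sum_nonneg fun k _ => mul_nonneg (sq_nonneg _) (inv_pos.2 (hc k)).le)
  set y : κ → ℝ := fun k => u k * (c k)⁻¹ with hy
  have huy : u ⬝ᵥ y = a := Finset.sum_congr rfl fun k _ => by simp only [hy]; ring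
  have hcy : diagonal c *ᵥ y = u := by
    ext k
    rw [mulVec_diagonal]
    have := (hc k).ne'
    simp only [hy]
    field_simp
  have hcu : u ᵥ* diagonal (fun k => (c k)⁻¹) = y := by
    ext k
    rw [vecMul_diagonal]
  have hcc : diagonal c * diagonal (fun k => (c k)⁻¹) = 1 := by
    rw [diagonal_mul_diagonal, ← diagonal_one]
    congr 1
    ext k
    exact mul_inv_cancel₀ (hc k).ne'
  have hinv : (diagonal c + vecMulVec u u)⁻¹ =
      diagonal (fun k => (c k)⁻¹) - (1 + a)⁻¹ • vecMulVec y y := by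
    refine inv_eq_right_inv ?_
    rw [Matrix.mul_sub, Matrix.add_mul, Matrix.mul_smul, Matrix.add_mul, hcc, vecMulVec_mul, hcu,
      mul_vecMulVec, hcy, vecMulVec_mul_vecMulVec, huy, vecMulVec_smul']
    have : vecMulVec u y + vecMulVec (a • u) y = (1 + a) • vecMulVec u y := by
      rw [smul_vecMulVec, add_smul, one_smul]
    rw [op_smul_eq_smul, this, smul_smul, inv_mul_cancel₀ ha0.ne', one_smul, add_sub_cancel_right]
  rw [hinv, trace_sub, trace_diagonal, trace_smul, trace_vecMulVec, smul_eq_mul, inv_mul_eq_div]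
  congr 2
  exact Finset.sum_congr rfl fun k _ => by simp only [hy]; ring

theorem exists_orthogonal_diagonalization {B : Matrix κ κ ℝ} (hB : B.PosDef) :
    ∃ (U : Matrix κ κ ℝ) (b : κ → ℝ), U * Uᵀ = 1 ∧ Uᵀ * U = 1 ∧ (∀ k, 0 < b k) ∧
      B = U * diagonal b * Uᵀ := by
  have h := hB.1.spectral_theorem
  refine ⟨hB.1.eigenvectorUnitary, hB.1.eigenvalues, ?_, ?_, hB.eigenvalues_pos, ?_⟩
  · simpa [star_eq_conjTranspose] using Unitary.coe_mul_star_self hB.1.eigenvectorUnitary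
  · simpa [star_eq_conjTranspose] using Unitary.coe_star_mul_self hB.1.eigenvectorUnitary
  · rw [Unitary.conjStarAlgAut_apply] at h
    simpa [star_eq_conjTranspose] using h

theorem trace_inv_conj {U X : Matrix κ κ ℝ} (h1 : U * Uᵀ = 1) (h2 : Uᵀ * U = 1)
    (hX : IsUnit X.det) : (U * X * Uᵀ)⁻¹.trace = X⁻¹.trace := by
  have : (U * X * Uᵀ)⁻¹ = U * X⁻¹ * Uᵀ := by
    refine inv_eq_right_inv ?_
    calc U * X * Uᵀ * (U * X⁻¹ * Uᵀ) = U * X * (Uᵀ * U) * X⁻¹ * Uᵀ := by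
          simp only [Matrix.mul_assoc]
      _ = U * (X * X⁻¹) * Uᵀ := by rw [h2, Matrix.mul_one]; simp only [Matrix.mul_assoc]
      _ = 1 := by rw [mul_nonsing_inv _ hX, Matrix.mul_one, h1]
  rw [this, trace_mul_cycle, h2, Matrix.one_mul]

/-- The lower barrier step for matrices. -/
theorem exists_trace_inv_le {B : Matrix κ κ ℝ} (hB : B.PosDef) {p δ : ℝ} (hδ : 0 < δ)
    (hδp : δ * (1 + p) ≤ 1) (hp : B⁻¹.trace ≤ p) {w : ι → ℝ} (hw : w ∈ stdSimplex ℝ ι)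
    {u : ι → κ → ℝ} (hu : infoMatrix u w = 1) :
    ∃ i, (B - δ • 1 + vecMulVec (u i) (u i)).PosDef ∧
      (B - δ • 1 + vecMulVec (u i) (u i))⁻¹.trace ≤ p := by
  obtain ⟨U, b, h1, h2, hb, rfl⟩ := exists_orthogonal_diagonalization hB
  have hbd : (diagonal b)⁻¹ = diagonal fun k => (b k)⁻¹ := by
    refine inv_eq_right_inv ?_
    rw [diagonal_mul_diagonal, ← diagonal_one]
    congr 1
    ext k
    exact mul_inv_cancel₀ (hb k).ne'
  have htr : ∑ k, (b k)⁻¹ ≤ p := by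
    rwa [trace_inv_conj h1 h2 (isUnit_det_of_posDef (posDef_diagonal_iff.2 hb)), hbd,
      trace_diagonal] at hp
  -- The potential keeps every eigenvalue away from the barrier: 1/b_k ≤ p and δp ≤ 1 − δ < 1, so
  -- the shift by δ stays below the spectrum.
  have hδb : ∀ k, δ < b k := fun k => by
    have h3 : (b k)⁻¹ ≤ p := (Finset.single_le_sum (f := fun k => (b k)⁻¹)
      (fun j _ => (inv_pos.2 (hb j)).le) (Finset.mem_univ k)).trans htr
    have h4 : δ * (b k)⁻¹ < 1 := by
      have := mul_le_mul_of_nonneg_left h3 hδ.le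
      linarith
    rwa [← div_eq_mul_inv, div_lt_one (hb k)] at h4
  have hsum : ∀ k, ∑ i, w i * (Uᵀ *ᵥ u i) k ^ 2 = 1 := fun k => by
    have h3 : Uᵀ * infoMatrix u w * U = 1 := by rw [hu, Matrix.mul_one, h2]
    have h4 := congrFun (congrFun h3 k) k
    rw [infoMatrix, Finset.mul_sum, Finset.sum_mul, Matrix.sum_apply, Matrix.one_apply_eq] at h4
    rw [← h4]
    refine Finset.sum_congr rfl fun i _ => ?_
    rw [Matrix.mul_smul, Matrix.smul_mul, mul_vecMulVec, vecMulVec_mul, ← mulVec_transpose,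
      Matrix.smul_apply, vecMulVec_apply, smul_eq_mul, pow_two]
  obtain ⟨i, hi⟩ := exists_barrier_step (U := fun i k => (Uᵀ *ᵥ u i) k ^ 2) hδ hδp hδb htr hw
    (fun i k => sq_nonneg _) hsum
  have hpd : (diagonal (fun k => b k - δ) + vecMulVec (Uᵀ *ᵥ u i) (Uᵀ *ᵥ u i)).PosDef :=
    (posDef_diagonal_iff.2 fun k => sub_pos.2 (hδb k)).add_posSemidef
      (posSemidef_vecMulVec_self_star _)
  have heq : U * diagonal b * Uᵀ - δ • 1 + vecMulVec (u i) (u i) =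
      U * (diagonal (fun k => b k - δ) + vecMulVec (Uᵀ *ᵥ u i) (Uᵀ *ᵥ u i)) * Uᵀ := by
    have h3 : diagonal (fun k => b k - δ) = diagonal b - δ • (1 : Matrix κ κ ℝ) := by
      rw [← diagonal_one, ← diagonal_smul, diagonal_sub]
      simp
    rw [h3, Matrix.mul_add, Matrix.add_mul, Matrix.mul_sub, Matrix.sub_mul, Matrix.mul_smul,
      Matrix.smul_mul, Matrix.mul_one, h1, mul_vecMulVec, vecMulVec_mul, vecMul_transpose,
      mulVec_mulVec, h1, one_mulVec]
  refine ⟨i, ?_, ?_⟩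
  · rw [heq]
    have hUu : IsUnit U := ⟨⟨U, Uᵀ, h1, h2⟩, rfl⟩
    have := (hUu.posDef_star_right_conjugate_iff (x := _)).2 hpd
    simpa [star_eq_conjTranspose] using this
  · rw [heq, trace_inv_conj h1 h2 (isUnit_det_of_posDef hpd),
      trace_inv_diagonal_add_vecMulVec fun k => sub_pos.2 (hδb k)]
    exact hi.trans htr

/-- `k` unit-weight vectors chosen along the barrier. -/
theorem exists_counts_barrier [Nonempty κ] {p : ℝ} (hp : 0 < p) {w : ι → ℝ}
    (hw : w ∈ stdSimplex ℝ ι) {u : ι → κ → ℝ} (hu : infoMatrix u w = 1) (k : ℕ) :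
    ∃ n : ι → ℕ, ∑ i, n i = k ∧
      (infoMatrix u (fun i => (n i : ℝ)) - (k / (1 + p) - Fintype.card κ / p) • 1).PosDef ∧
      (infoMatrix u (fun i => (n i : ℝ)) - (k / (1 + p) - Fintype.card κ / p) • 1)⁻¹.trace
        ≤ p := by
  classical
  have hM : (0 : ℝ) < Fintype.card κ := by exact_mod_cast Fintype.card_pos
  induction k with
  | zero =>
    -- The barrier starts at −M/p, M the dimension, where the potential of the empty sum is exactly
    -- p. Each step raises it by 1/(1 + p), the largest shift that `exists_trace_inv_le` allows.
    refine ⟨0, by simp, ?_⟩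
    have h0 : infoMatrix u (fun i => (((0 : ι → ℕ) i : ℕ) : ℝ)) -
        (((0 : ℕ) : ℝ) / (1 + p) - Fintype.card κ / p) • 1 =
        (Fintype.card κ / p : ℝ) • (1 : Matrix κ κ ℝ) := by
      simp [infoMatrix]
    rw [h0]
    refine ⟨PosDef.one.smul (by positivity), ?_⟩
    have : ((Fintype.card κ / p : ℝ) • (1 : Matrix κ κ ℝ))⁻¹ = (p / Fintype.card κ : ℝ) • 1 := by
      refine inv_eq_right_inv ?_
      rw [smul_mul_smul_comm, Matrix.one_mul, div_mul_div_comm, mul_comm p, div_self (by positivity),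
        one_smul]
    rw [this, trace_smul, trace_one, smul_eq_mul, div_mul_cancel₀ _ hM.ne']
  | succ k ih =>
    obtain ⟨n, hn, hpd, htr⟩ := ih
    have h1p : 0 < 1 + p := by linarith
    obtain ⟨i, hi1, hi2⟩ := exists_trace_inv_le hpd (δ := 1 / (1 + p)) (by positivity)
      (by rw [one_div_mul_cancel h1p.ne']) htr hw hu
    refine ⟨n + Pi.single i 1, ?_, ?_⟩
    · simp [Finset.sum_add_distrib, hn]
    · have heq : infoMatrix u (fun j => ((n + Pi.single i 1 : ι → ℕ) j : ℝ)) -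
          (((k + 1 : ℕ) : ℝ) / (1 + p) - Fintype.card κ / p) • 1 =
          infoMatrix u (fun i => (n i : ℝ)) - (k / (1 + p) - Fintype.card κ / p : ℝ) • 1
            - (1 / (1 + p) : ℝ) • 1 + vecMulVec (u i) (u i) := by
        rw [infoMatrix_add_single]
        have : ((k + 1 : ℕ) : ℝ) / (1 + p) - Fintype.card κ / p =
          (k / (1 + p) - Fintype.card κ / p) + 1 / (1 + p) := by push_cast; ring
        rw [this, add_smul]
        abel
      rw [heq]
      exact ⟨hi1, hi2⟩

/-- Near-optimal rounding: `k` pulls keep the information matrix above the ideal one, up to a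
factor `1 + p` and an additive loss of `card κ / p` pulls. -/
theorem exists_counts_ge [Nonempty κ] {p : ℝ} (hp : 0 < p) {v : ι → κ → ℝ} {w : ι → ℝ}
    (hw : w ∈ stdSimplex ℝ ι) (hA : (infoMatrix v w).PosDef) (k : ℕ) :
    ∃ n : ι → ℕ, ∑ i, n i = k ∧ ∀ z, (k / (1 + p) - Fintype.card κ / p) *
      (z ⬝ᵥ (infoMatrix v w *ᵥ z)) ≤ z ⬝ᵥ (infoMatrix v (fun i => (n i : ℝ)) *ᵥ z) := by
  open scoped MatrixOrder in
  obtain ⟨R, hR⟩ := CStarAlgebra.nonneg_iff_eq_star_mul_self.mp hA.posSemidef.nonneg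
  rw [star_eq_conjTranspose, conjTranspose_eq_transpose_of_trivial] at hR
  have hRu : IsUnit R.det := by
    have := isUnit_det_of_posDef hA
    rw [hR, det_mul] at this
    exact isUnit_of_mul_isUnit_right this
  -- Whitening: with information matrix RᵀR, the vectors v_i R⁻¹ have information matrix 1 under w.
  set u : ι → κ → ℝ := fun i => v i ᵥ* R⁻¹ with hu
  have huv : ∀ i z, u i ⬝ᵥ (R *ᵥ z) = v i ⬝ᵥ z := fun i z => by
    rw [hu, dotProduct_mulVec, vecMul_vecMul, nonsing_inv_mul _ hRu, vecMul_one]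
  have hu1 : infoMatrix u w = 1 := by
    have h1 : infoMatrix u w = (R⁻¹)ᵀ * infoMatrix v w * R⁻¹ := by
      simp only [infoMatrix, Finset.mul_sum, Finset.sum_mul, Matrix.mul_smul, Matrix.smul_mul,
        mul_vecMulVec, vecMulVec_mul, mulVec_transpose, hu]
    rw [h1, hR, ← Matrix.mul_assoc, Matrix.mul_assoc _ R, mul_nonsing_inv _ hRu, Matrix.mul_one,
      ← transpose_mul, mul_nonsing_inv _ hRu, transpose_one]
  obtain ⟨n, hn, hpd, -⟩ := exists_counts_barrier hp hw hu1 k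
  refine ⟨n, hn, fun z => ?_⟩
  have h1 := hpd.posSemidef.dotProduct_mulVec_nonneg (R *ᵥ z)
  rw [star_trivial, sub_mulVec, smul_mulVec, one_mulVec, dotProduct_sub, dotProduct_smul,
    smul_eq_mul, dotProduct_infoMatrix_mulVec] at h1
  simp only [huv] at h1
  have h2 : z ⬝ᵥ (infoMatrix v w *ᵥ z) = (R *ᵥ z) ⬝ᵥ (R *ᵥ z) := by
    rw [hR, ← mulVec_mulVec, dotProduct_mulVec, vecMul_transpose]
  rw [h2, dotProduct_infoMatrix_mulVec]
  linarith

theorem exists_isEfficientRounding [Nonempty ι] [Nonempty κ] {v : ι → κ → ℝ} {w : ι → ℝ}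
    (h : IsGOptimal v w) {ε N : ℝ} (hε : 0 < ε) (hε' : ε ≤ 1 / 3)
    (hN : 2 * Fintype.card κ / ε ^ 2 ≤ N) : ∃ n, IsEfficientRounding v ε N w n := by
  have hM : (1 : ℝ) ≤ Fintype.card κ := by exact_mod_cast Fintype.card_pos (α := κ)
  have hN0 : 0 < N := lt_of_lt_of_le (by positivity) hN
  obtain ⟨n, hn, hle⟩ := exists_counts_ge hε h.1 h.posDef ⌊N⌋₊
  set l : ℝ := ⌊N⌋₊ / (1 + ε) - Fintype.card κ / ε with hl
  -- The slack N/(1 + ε) − N/(1 + 6ε) is of order εN. It must absorb the floor, which costs less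
  -- than one pull, and the barrier loss M/ε. The assumption on N makes both 1 and M at most Nε²/2.
  have hlN : N / (1 + 6 * ε) ≤ l := by
    have h1 : N - 1 ≤ ⌊N⌋₊ := by linarith [Nat.lt_floor_add_one N]
    have h2 : (N - 1) / (1 + ε) ≤ ⌊N⌋₊ / (1 + ε) := by gcongr
    have h3 : 2 * Fintype.card κ ≤ N * ε ^ 2 := by rwa [div_le_iff₀ (by positivity)] at hN
    have h4 : N / (1 + 6 * ε) ≤ (N - 1) / (1 + ε) - Fintype.card κ / ε := by
      rw [div_sub_div _ _ (by positivity) hε.ne', div_le_div_iff₀ (by positivity) (by positivity)]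
      have e1 : (1 + ε) * Fintype.card κ ≤ (1 + ε) * (N * ε ^ 2 / 2) := by gcongr; linarith
      have e2 : 1 ≤ N * ε ^ 2 / 2 := by linarith
      have e3 : ε * 1 ≤ ε * (N * ε ^ 2 / 2) := by gcongr
      have e5 : (ε + (1 + ε) * Fintype.card κ) * (1 + 6 * ε) ≤
          (ε * (N * ε ^ 2 / 2) + (1 + ε) * (N * ε ^ 2 / 2)) * (1 + 6 * ε) := by
        gcongr; linarith
      have e6 : (1 + 2 * ε) * (1 + 6 * ε) / 2 ≤ 5 := by nlinarith
      have e7 : N * ε ^ 2 * ((1 + 2 * ε) * (1 + 6 * ε) / 2) ≤ N * ε ^ 2 * 5 := by gcongr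
      nlinarith
    linarith
  have hl0 : 0 < l := lt_of_lt_of_le (by positivity) hlN
  have hn0 : ∀ i, (0 : ℝ) ≤ n i := fun i => Nat.cast_nonneg _
  have hpd : (infoMatrix v fun i => (n i : ℝ)).PosDef := by
    refine .of_dotProduct_mulVec_pos (infoMatrix_posSemidef v hn0).1 fun z hz => ?_
    have h1 := h.posDef.dotProduct_mulVec_pos hz
    rw [star_trivial] at *
    exact (mul_pos hl0 h1).trans_le (hle z)
  refine ⟨n, ?_, isUnit_det_of_posDef hpd, ?_⟩
  · rw [← Nat.cast_sum, hn]
    exact Nat.floor_le hN0.le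
  · rw [maxPredVar_smul v h.2.1 hN0]
    refine ciSup_le fun i => ?_
    refine (dotProduct_inv_mulVec_le h.posDef (isUnit_det_of_posDef hpd) hl0 hle _).trans ?_
    rw [← mul_assoc]
    have h1 := le_maxPredVar v w i
    have h2 := dotProduct_inv_mulVec_nonneg h.posDef (v i)
    have h3 : l⁻¹ ≤ (1 + 6 * ε) * N⁻¹ := by
      rw [← div_eq_mul_inv, ← inv_div]
      exact inv_anti₀ (by positivity) hlN
    gcongr

end Rounding

/-! ### Tail bounds for linear and quadratic sums of sub-Gaussian noises. -/

section Concentration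

/-- Compare power series: from order two on, |t| ≤ 1 lets t² be factored out. The linear term stays
exact, so that it vanishes on integrating a centered variable. -/
theorem exp_mul_le_one_add {t y : ℝ} (ht : |t| ≤ 1) :
    Real.exp (t * y) ≤ 1 + t * y + t ^ 2 * Real.exp |y| := by
  have h1 : HasSum (fun n : ℕ => (t * y) ^ n / n.factorial) (Real.exp (t * y)) := by
    rw [Real.exp_eq_exp_ℝ]
    exact NormedSpace.expSeries_div_hasSum_exp _
  have h2 : HasSum (fun n : ℕ => |y| ^ n / n.factorial) (Real.exp |y|) := by
    rw [Real.exp_eq_exp_ℝ]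
    exact NormedSpace.expSeries_div_hasSum_exp _
  have h3 : HasSum (fun n : ℕ => if n ∈ Finset.range 2 then (t * y) ^ n / n.factorial else 0)
      (∑ n ∈ Finset.range 2, (t * y) ^ n / n.factorial) := by
    rw [← Finset.sum_congr rfl fun n (hn : n ∈ Finset.range 2) =>
      if_pos (c := n ∈ Finset.range 2) (t := (t * y) ^ n / (n.factorial : ℝ)) (e := 0) hn]
    exact hasSum_sum_of_ne_finset_zero fun n hn => if_neg hn
  have h4 := hasSum_le (fun n => ?_) h1 (h3.add (h2.mul_left (t ^ 2)))
  · simpa [Finset.sum_range_succ] using h4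
  · have hy : 0 ≤ t ^ 2 * (|y| ^ n / n.factorial) := by positivity
    by_cases hn : n ∈ Finset.range 2
    · rw [if_pos hn]
      linarith
    · rw [if_neg hn, zero_add]
      obtain ⟨m, rfl⟩ : ∃ m, n = m + 2 := ⟨n - 2, by simp at hn; omega⟩
      rw [← mul_div_assoc]
      gcongr
      calc (t * y) ^ (m + 2) ≤ |(t * y) ^ (m + 2)| := le_abs_self _
        _ = |t| ^ m * (t ^ 2 * |y| ^ (m + 2)) := by
          rw [abs_pow, abs_mul, mul_pow, pow_add |t|, sq_abs]; ring
        _ ≤ 1 * (t ^ 2 * |y| ^ (m + 2)) := by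
          gcongr
          exact pow_le_one₀ (abs_nonneg t) ht
        _ = _ := one_mul _

theorem lintegral_exp_mul_gaussianReal (t : ℝ) :
    ∫⁻ g, ENNReal.ofReal (Real.exp (t * g)) ∂(gaussianReal 0 1) =
      ENNReal.ofReal (Real.exp (t ^ 2 / 2)) := by
  rw [← ofReal_integral_eq_lintegral_ofReal (integrable_exp_mul_gaussianReal t)
    (ae_of_all _ fun _ => (Real.exp_pos _).le)]
  have : mgf id (gaussianReal 0 1) t = _ := mgf_gaussianReal Measure.map_id t
  simp only [mgf, id] at this
  rw [this]
  simp

/-- The weight turns the standard Gaussian density into √2 times the density of variance 2. -/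
theorem lintegral_exp_sq_gaussianReal :
    ∫⁻ g, ENNReal.ofReal (Real.exp (g ^ 2 / 4)) ∂(gaussianReal 0 1) = ENNReal.ofReal (√2) := by
  rw [gaussianReal_of_var_ne_zero _ one_ne_zero,
    lintegral_withDensity_eq_lintegral_mul _ (measurable_gaussianPDF _ _) (by fun_prop)]
  have h : ∀ g : ℝ, (gaussianPDF 0 1 * fun g => ENNReal.ofReal (Real.exp (g ^ 2 / 4))) g =
      ENNReal.ofReal (√2) * gaussianPDF 0 2 g := fun g => by
    simp only [Pi.mul_apply, gaussianPDF]
    rw [← ENNReal.ofReal_mul (gaussianPDFReal_nonneg _ _ _),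
      ← ENNReal.ofReal_mul (Real.sqrt_nonneg _)]
    congr 1
    simp only [gaussianPDFReal, NNReal.coe_one, NNReal.coe_ofNat, sub_zero, mul_one]
    rw [mul_assoc, ← Real.exp_add, ← mul_assoc]
    congr 1
    · rw [mul_comm (2 * Real.pi) 2, Real.sqrt_mul zero_le_two (2 * Real.pi), mul_inv, ← mul_assoc,
        mul_inv_cancel₀ (by positivity), one_mul]
    · congr 1
      ring
  rw [lintegral_congr h, lintegral_const_mul _ (measurable_gaussianPDF _ _),
    lintegral_gaussianPDF_eq_one 0 two_ne_zero, mul_one]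

variable {Ω : Type*} [MeasurableSpace Ω] {μ : Measure Ω}

/-- Gaussian linearization: exp(Z²/(4v)) is the average of exp(sZg) over a standard Gaussian g, with
s² = 1/(2v). After Tonelli, the sub-Gaussian bound at sg gives exp(g²/4). -/
theorem lintegral_exp_sq_le [SFinite μ] {Z : Ω → ℝ} {v : ℝ} (hv : 0 < v)
    (h : HasSubgaussianMGF Z v.toNNReal μ) :
    ∫⁻ ω, ENNReal.ofReal (Real.exp (Z ω ^ 2 / (4 * v))) ∂μ ≤ ENNReal.ofReal (√2) := by
  have hZ := h.aemeasurable
  set s : ℝ := (√(2 * v))⁻¹ with hs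
  have hs2 : s ^ 2 = (2 * v)⁻¹ := by rw [hs, inv_pow, Real.sq_sqrt (by positivity)]
  calc ∫⁻ ω, ENNReal.ofReal (Real.exp (Z ω ^ 2 / (4 * v))) ∂μ
      = ∫⁻ ω, ∫⁻ g, ENNReal.ofReal (Real.exp (s * Z ω * g)) ∂(gaussianReal 0 1) ∂μ := by
        refine lintegral_congr fun ω => ?_
        rw [lintegral_exp_mul_gaussianReal, mul_pow, hs2]
        congr 2
        field_simp
        ring
    _ = ∫⁻ g, ∫⁻ ω, ENNReal.ofReal (Real.exp (s * Z ω * g)) ∂μ ∂(gaussianReal 0 1) := by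
        refine lintegral_lintegral_swap ?_
        have h1 : AEMeasurable (fun p : Ω × ℝ => Z p.1) (μ.prod (gaussianReal 0 1)) :=
          hZ.comp_fst
        have h2 : AEMeasurable (fun p : Ω × ℝ => s * Z p.1 * p.2) (μ.prod (gaussianReal 0 1)) :=
          (h1.const_mul s).mul measurable_snd.aemeasurable
        exact (Real.measurable_exp.comp_aemeasurable h2).ennreal_ofReal
    _ ≤ ∫⁻ g, ENNReal.ofReal (Real.exp (g ^ 2 / 4)) ∂(gaussianReal 0 1) := by
        refine lintegral_mono fun g => ?_
        have h1 : ∀ ω, s * Z ω * g = s * g * Z ω := fun ω => by ring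
        simp only [h1]
        rw [← ofReal_integral_eq_lintegral_ofReal (h.integrable_exp_mul _)
          (ae_of_all _ fun _ => (Real.exp_pos _).le)]
        refine ENNReal.ofReal_le_ofReal ((h.mgf_le (s * g)).trans (le_of_eq ?_))
        rw [Real.coe_toNNReal _ hv.le, mul_pow, hs2]
        congr 1
        field_simp
        ring
    _ = ENNReal.ofReal (√2) := lintegral_exp_sq_gaussianReal

/-- Turns the factor 16·exp(1/4)·√2 of the moment bound below into 32. -/
theorem exp_quarter_mul_sqrt_two_le : Real.exp (1 / 4) * √2 ≤ 2 := by
  have h1 : Real.exp (1 / 4) ≤ √2 := by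
    refine Real.le_sqrt_of_sq_le ?_
    rw [← Real.exp_nat_mul, ← Real.le_log_iff_exp_le two_pos]
    have := Real.log_two_gt_d9
    norm_num at this ⊢
    linarith
  calc _ ≤ √2 * √2 := by gcongr
    _ = 2 := Real.mul_self_sqrt zero_le_two

/-- The centered square of a strictly sub-Gaussian variable is sub-exponential. -/
theorem IsStrictlySubGaussian.mgf_sq_sub_le [IsProbabilityMeasure μ] {Z : Ω → ℝ} {v : ℝ}
    (hv : 0 < v) (h : IsStrictlySubGaussian Z v μ) {s : ℝ} (hs : |s| ≤ 1 / (4 * v)) :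
    Integrable (fun ω => Real.exp (s * (Z ω ^ 2 - v))) μ ∧
      mgf (fun ω => Z ω ^ 2 - v) μ s ≤ Real.exp (32 * s ^ 2 * v ^ 2) := by
  obtain ⟨hsub, -, hvar⟩ := h
  have hZ := hsub.aemeasurable
  have hle := lintegral_exp_sq_le hv hsub
  have hm : AEStronglyMeasurable (fun ω => Real.exp (Z ω ^ 2 / (4 * v))) μ :=
    (Real.measurable_exp.comp_aemeasurable ((hZ.pow_const 2).div_const _)).aestronglyMeasurable
  have hint : Integrable (fun ω => Real.exp (Z ω ^ 2 / (4 * v))) μ := by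
    refine ⟨hm, ?_⟩
    rw [hasFiniteIntegral_iff_ofReal (ae_of_all _ fun _ => (Real.exp_pos _).le)]
    exact hle.trans_lt ENNReal.ofReal_lt_top
  have hval : ∫ ω, Real.exp (Z ω ^ 2 / (4 * v)) ∂μ ≤ √2 := by
    rw [← ofReal_integral_eq_lintegral_ofReal hint (ae_of_all _ fun _ => (Real.exp_pos _).le)]
      at hle
    exact (ENNReal.ofReal_le_ofReal_iff (Real.sqrt_nonneg 2)).1 hle
  have hint2 : Integrable (fun ω => Z ω ^ 2) μ := (hsub.memLp 2).integrable_sq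
  -- `exp_mul_le_one_add` with t = 4vs, in [−1, 1] by the range of s, and y = (Z² − v)/(4v), for
  -- which |y| ≤ 1/4 + Z²/(4v).
  have hpt : ∀ ω, Real.exp (s * (Z ω ^ 2 - v)) ≤ 1 + s * (Z ω ^ 2 - v) +
      16 * s ^ 2 * v ^ 2 * Real.exp (1 / 4) * Real.exp (Z ω ^ 2 / (4 * v)) := fun ω => by
    have ht : |4 * v * s| ≤ 1 := by
      rw [abs_mul, abs_of_pos (by positivity)]
      rwa [le_div_iff₀' (by positivity)] at hs
    have h1 := exp_mul_le_one_add (y := (Z ω ^ 2 - v) / (4 * v)) ht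
    have h2 : 4 * v * s * ((Z ω ^ 2 - v) / (4 * v)) = s * (Z ω ^ 2 - v) := by field_simp
    have h3 : |(Z ω ^ 2 - v) / (4 * v)| ≤ 1 / 4 + Z ω ^ 2 / (4 * v) := by
      rw [abs_div, abs_of_pos (a := 4 * v) (by positivity), div_add_div _ _ (by positivity)
        (by positivity), div_le_div_iff₀ (by positivity) (by positivity)]
      have : |Z ω ^ 2 - v| ≤ Z ω ^ 2 + v :=
        abs_le.2 ⟨by nlinarith [sq_nonneg (Z ω)], by linarith⟩
      nlinarith [mul_le_mul_of_nonneg_right this (by positivity : 0 ≤ 4 * (4 * v))]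
    rw [h2] at h1
    have h4 := Real.exp_le_exp.2 h3
    rw [Real.exp_add] at h4
    have h5 : (4 * v * s) ^ 2 * Real.exp |(Z ω ^ 2 - v) / (4 * v)| ≤
        (4 * v * s) ^ 2 * (Real.exp (1 / 4) * Real.exp (Z ω ^ 2 / (4 * v))) := by gcongr
    calc _ ≤ _ := h1
      _ ≤ 1 + s * (Z ω ^ 2 - v) +
        (4 * v * s) ^ 2 * (Real.exp (1 / 4) * Real.exp (Z ω ^ 2 / (4 * v))) := by gcongr
      _ = _ := by ring
  have hcent : Integrable (fun ω => Z ω ^ 2 - v) μ := hint2.sub (integrable_const _)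
  have hlin : Integrable (fun ω => 1 + s * (Z ω ^ 2 - v)) μ :=
    (integrable_const _).add (hcent.const_mul _)
  have hbound := hlin.add (hint.const_mul (16 * s ^ 2 * v ^ 2 * Real.exp (1 / 4)))
  have hfin : Integrable (fun ω => Real.exp (s * (Z ω ^ 2 - v))) μ := by
    refine hbound.mono' (Real.measurable_exp.comp_aemeasurable
      (((hZ.pow_const 2).sub_const v).const_mul s)).aestronglyMeasurable (ae_of_all _ fun ω => ?_)
    rw [Real.norm_of_nonneg (Real.exp_pos _).le]
    exact hpt ω
  refine ⟨hfin, ?_⟩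
  calc mgf (fun ω => Z ω ^ 2 - v) μ s
      ≤ ∫ ω, (1 + s * (Z ω ^ 2 - v)) +
        16 * s ^ 2 * v ^ 2 * Real.exp (1 / 4) * Real.exp (Z ω ^ 2 / (4 * v)) ∂μ :=
        integral_mono hfin hbound hpt
    _ = 1 + 16 * s ^ 2 * v ^ 2 * Real.exp (1 / 4) * ∫ ω, Real.exp (Z ω ^ 2 / (4 * v)) ∂μ := by
        -- The linear term vanishes because the second moment equals the proxy v, not merely because
        -- it is bounded by it.
        have h1 : ∫ ω, (Z ω ^ 2 - v) ∂μ = 0 := by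
          rw [integral_sub hint2 (integrable_const _), hvar]
          simp
        have h2 : ∫ ω, (1 + s * (Z ω ^ 2 - v)) ∂μ = 1 := by
          rw [integral_add (integrable_const _) (hcent.const_mul s), integral_const_mul, h1]
          simp
        rw [integral_add hlin (hint.const_mul _), integral_const_mul, h2]
    _ ≤ 1 + 16 * s ^ 2 * v ^ 2 * Real.exp (1 / 4) * √2 := by gcongr
    _ ≤ 32 * s ^ 2 * v ^ 2 + 1 := by
        have := mul_le_mul_of_nonneg_left exp_quarter_mul_sqrt_two_le
          (by positivity : 0 ≤ 16 * s ^ 2 * v ^ 2)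
        nlinarith
    _ ≤ Real.exp (32 * s ^ 2 * v ^ 2) := Real.add_one_le_exp _

variable {T : Type*} [Fintype T]

/-- Bernstein bound for weighted sums of centered squares. -/
theorem measureReal_sum_sq_sub_ge_le [IsProbabilityMeasure μ] {η : T → Ω → ℝ} {v a : T → ℝ}
    (hind : iIndepFun η μ) (hη : ∀ t, IsStrictlySubGaussian (η t) (v t) μ) {V R l : ℝ}
    (hv : ∀ t, 0 < v t) (hV : 0 < V) (hvV : ∀ t, v t ≤ V) (hR : 0 < R) (hl : 0 ≤ l)
    (haR : ∑ t, a t ^ 2 ≤ R) (ha : ∀ t, |a t| ≤ R) (hlR : l * R ≤ 1) :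
    μ.real {ω | 28 * V * √(l * R) ≤ ∑ t, a t * (η t ω ^ 2 - v t)} ≤ Real.exp (-5 * l) := by
  -- With this s, lR ≤ 1 keeps s·a_t in the range of `mgf_sq_sub_le`. The moment generating function
  -- costs 32s²V²R = 2l and the threshold gains 28V√(lR)·s = 7l, a net exponent of −5l.
  set s : ℝ := √(l * R) / (4 * V * R) with hs
  have hs0 : 0 ≤ s := by positivity
  have hq : √(l * R) ^ 2 = l * R := Real.sq_sqrt (by positivity)
  have hq1 : √(l * R) ≤ 1 := Real.sqrt_le_one.2 hlR
  have hsa : ∀ t, |s * a t| ≤ 1 / (4 * v t) := fun t => by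
    have h0 := hv t
    rw [abs_mul, abs_of_nonneg hs0]
    calc s * |a t| ≤ s * R := by gcongr; exact ha t
      _ = √(l * R) / (4 * V) := by rw [hs]; field_simp
      _ ≤ 1 / (4 * v t) := by gcongr; exact hvV t
  have hbd := fun t => (hη t).mgf_sq_sub_le (hv t) (hsa t)
  have hind' : iIndepFun (fun t ω => a t * (η t ω ^ 2 - v t)) μ :=
    hind.comp (fun t y => a t * (y ^ 2 - v t)) fun t => by fun_prop
  have hmeas : ∀ t, AEMeasurable (fun ω => a t * (η t ω ^ 2 - v t)) μ := fun t =>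
    (((hη t).1.aemeasurable.pow_const 2).sub_const _).const_mul _
  have hmgf : ∀ t, mgf (fun ω => a t * (η t ω ^ 2 - v t)) μ s =
      mgf (fun ω => η t ω ^ 2 - v t) μ (s * a t) := fun t => by
    simp only [mgf, mul_assoc]
  have hprod := hind'.mgf_sum₀ hmeas (t := s) Finset.univ
  have hpos : 0 < mgf (∑ t, fun ω => a t * (η t ω ^ 2 - v t)) μ s := by
    rw [hprod]
    refine Finset.prod_pos fun t _ => ?_
    rw [hmgf]
    exact mgf_pos (hbd t).1
  have hint := mgf_pos_iff.1 hpos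
  have hch := measure_ge_le_exp_mul_mgf (28 * V * √(l * R)) hs0 hint
  simp only [Finset.sum_apply] at hch
  refine hch.trans ?_
  rw [hprod]
  have hmle : ∏ t, mgf (fun ω => a t * (η t ω ^ 2 - v t)) μ s ≤ Real.exp (2 * l) := by
    calc _ ≤ ∏ t, Real.exp (32 * s ^ 2 * V ^ 2 * a t ^ 2) := by
          refine Finset.prod_le_prod (fun t _ => mgf_nonneg) fun t _ => ?_
          rw [hmgf]
          refine (hbd t).2.trans (Real.exp_le_exp.2 ?_)
          have h0 := hv t
          calc 32 * (s * a t) ^ 2 * v t ^ 2 = 32 * s ^ 2 * v t ^ 2 * a t ^ 2 := by ring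
            _ ≤ _ := by gcongr; exact hvV t
      _ = Real.exp (32 * s ^ 2 * V ^ 2 * ∑ t, a t ^ 2) := by
          rw [← Real.exp_sum, Finset.mul_sum]
      _ ≤ Real.exp (2 * l) := by
          refine Real.exp_le_exp.2 ?_
          calc _ ≤ 32 * s ^ 2 * V ^ 2 * R := by gcongr
            _ = 2 * (√(l * R) ^ 2) / R := by rw [hs]; field_simp; ring
            _ = 2 * l := by rw [hq]; field_simp
  calc _ ≤ Real.exp (-s * (28 * V * √(l * R))) * Real.exp (2 * l) := by gcongr
    _ = Real.exp (-5 * l) := by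
      rw [← Real.exp_add]
      congr 1
      have : s * (28 * V * √(l * R)) = 7 * l := by
        calc _ = 7 * √(l * R) ^ 2 / R := by rw [hs]; field_simp; ring
          _ = 7 * l := by rw [hq]; field_simp
      linarith

theorem measureReal_abs_sum_sq_sub_ge_le [IsProbabilityMeasure μ] {η : T → Ω → ℝ} {v a : T → ℝ}
    (hind : iIndepFun η μ) (hη : ∀ t, IsStrictlySubGaussian (η t) (v t) μ) {V R l : ℝ}
    (hv : ∀ t, 0 < v t) (hV : 0 < V) (hvV : ∀ t, v t ≤ V) (hR : 0 < R) (hl : 0 ≤ l)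
    (haR : ∑ t, a t ^ 2 ≤ R) (ha : ∀ t, |a t| ≤ R) (hlR : l * R ≤ 1) :
    μ.real {ω | 28 * V * √(l * R) ≤ |∑ t, a t * (η t ω ^ 2 - v t)|} ≤ 2 * Real.exp (-5 * l) := by
  have h1 := measureReal_sum_sq_sub_ge_le hind hη hv hV hvV hR hl haR ha hlR
  have h2 := measureReal_sum_sq_sub_ge_le (a := fun t => -a t) hind hη hv hV hvV hR hl
    (by simpa using haR) (by simpa using ha) hlR
  simp only [neg_mul, Finset.sum_neg_distrib] at h2
  simp only [le_abs, Set.ofPred_or]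
  refine (measureReal_union_le _ _).trans ?_
  simp only [neg_mul] at h1 ⊢
  linarith

theorem measureReal_abs_sum_ge_le [IsProbabilityMeasure μ] {η : T → Ω → ℝ} {c : T → NNReal}
    {b : T → ℝ} (hind : iIndepFun η μ) (hη : ∀ t, HasSubgaussianMGF (η t) (c t) μ) {V R l : ℝ}
    (hV : 0 < V) (hvV : ∀ t, (c t : ℝ) ≤ V) (hR : 0 < R) (hl : 0 ≤ l) (hb : ∑ t, b t ^ 2 ≤ R) :
    μ.real {ω | √(10 * l * (V * R)) ≤ |∑ t, b t * η t ω|} ≤ 2 * Real.exp (-5 * l) := by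
  have hind' : iIndepFun (fun t ω => b t * η t ω) μ :=
    hind.comp (fun t y => b t * y) fun t => by fun_prop
  have h0 := HasSubgaussianMGF.sum_of_iIndepFun hind' (s := Finset.univ)
    fun t _ => (hη t).const_mul (b t)
  have hcoe : ((∑ t, (⟨b t ^ 2, sq_nonneg _⟩ * c t : NNReal) : NNReal) : ℝ) ≤ V * R := by
    push_cast
    calc ∑ t, b t ^ 2 * (c t : ℝ) ≤ ∑ t, b t ^ 2 * V :=
          Finset.sum_le_sum fun t _ => by gcongr; exact hvV t
      _ = V * ∑ t, b t ^ 2 := by rw [← Finset.sum_mul, mul_comm]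
      _ ≤ V * R := by gcongr
  have h1 : HasSubgaussianMGF (fun ω => ∑ t, b t * η t ω) (V * R).toNNReal μ := by
    refine ⟨h0.integrable_exp_mul, fun s => (h0.mgf_le s).trans (Real.exp_le_exp.2 ?_)⟩
    rw [Real.coe_toNNReal _ (by positivity)]
    gcongr
  have hexp : -√(10 * l * (V * R)) ^ 2 / (2 * ((V * R).toNNReal : ℝ)) = -5 * l := by
    rw [Real.coe_toNNReal _ (by positivity), Real.sq_sqrt (by positivity)]
    field_simp
    ring
  have h2 := h1.measure_ge_le (Real.sqrt_nonneg (10 * l * (V * R)))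
  have h3 := h1.neg.measure_ge_le (Real.sqrt_nonneg (10 * l * (V * R)))
  rw [hexp] at h2 h3
  simp only [Pi.neg_apply] at h3
  simp only [le_abs, Set.ofPred_or]
  refine (measureReal_union_le _ _).trans ?_
  linarith

/-- A bound on every slice of an event bounds the event, for independent variables. -/
theorem measureReal_prodMk_mem_le [IsProbabilityMeasure μ] {E F : Type*} [MeasurableSpace E]
    [MeasurableSpace F] {Y : Ω → E} {Z : Ω → F} (hY : AEMeasurable Y μ) (hZ : AEMeasurable Z μ)
    (hind : IndepFun Y Z μ) {G : Set (E × F)} (hG : MeasurableSet G) {b : ℝ}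
    (hb : ∀ y, μ.real {ω | (y, Z ω) ∈ G} ≤ b) : μ.real {ω | (Y ω, Z ω) ∈ G} ≤ b := by
  have hb0 : 0 ≤ b := by
    obtain ⟨ω⟩ : Nonempty Ω := μ.nonempty_of_neZero
    exact measureReal_nonneg.trans (hb (Y ω))
  have hYp : IsProbabilityMeasure (μ.map Y) := Measure.isProbabilityMeasure_map hY
  have h1 : μ {ω | (Y ω, Z ω) ∈ G} = (μ.map Y).prod (μ.map Z) G := by
    rw [← hind.map_prod_eq_prod_map_map hY hZ,
      Measure.map_apply_of_aemeasurable (hY.prodMk hZ) hG]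
    rfl
  have h2 : μ {ω | (Y ω, Z ω) ∈ G} ≤ ENNReal.ofReal b := by
    rw [h1, Measure.prod_apply hG]
    calc _ ≤ ∫⁻ _, ENNReal.ofReal b ∂(μ.map Y) := by
          refine lintegral_mono fun y => ?_
          rw [Measure.map_apply_of_aemeasurable hZ (measurable_prodMk_left hG)]
          rw [← ENNReal.ofReal_toReal (measure_ne_top μ _)]
          exact ENNReal.ofReal_le_ofReal (hb y)
      _ = ENNReal.ofReal b := by simp
  exact ENNReal.toReal_le_of_le_ofReal hb0 h2

/-- Grouping the noises by stage permits conditioning on the whole first stage. -/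
theorem indepFun_of_iIndepFun_sumElim {T₁ T₂ : Type*} [Fintype T₁] [Fintype T₂]
    {η₁ : T₁ → Ω → ℝ} {η₂ : T₂ → Ω → ℝ} (h : iIndepFun (Sum.elim η₁ η₂) μ)
    (h₁ : ∀ t, AEMeasurable (η₁ t) μ) (h₂ : ∀ t, AEMeasurable (η₂ t) μ) :
    IndepFun (fun ω t => η₁ t ω) (fun ω t => η₂ t ω) μ := by
  classical
  set S : Finset (T₁ ⊕ T₂) := Finset.univ.map .inl
  set S' : Finset (T₁ ⊕ T₂) := Finset.univ.map .inr
  have hd : Disjoint S S' := by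
    rw [Finset.disjoint_left]
    intro x hx hx'
    simp only [S, S', Finset.mem_map, Finset.mem_univ, true_and] at hx hx'
    obtain ⟨a, rfl⟩ := hx
    obtain ⟨b, hb⟩ := hx'
    simp at hb
  have h0 := h.indepFun_finset₀ S S' hd (by rintro (t | t); exacts [h₁ t, h₂ t])
  let φ : (S → ℝ) → T₁ → ℝ := fun f t => f ⟨.inl t, by simp [S]⟩
  let ψ : (S' → ℝ) → T₂ → ℝ := fun f t => f ⟨.inr t, by simp [S']⟩
  exact h0.comp (φ := φ) (ψ := ψ) (by fun_prop) (by fun_prop)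

end Concentration

/-! ### The three error terms of the two-stage estimate. -/

section TwoStage

variable {Ω : Type*} [MeasurableSpace Ω] {μ : Measure Ω}
variable {I T₁ T₂ : Type*} [Fintype I] [Fintype T₁] [Fintype T₂]

/-- The cross term between the noises of the two stages, when the first stage is accurate. -/
theorem measureReal_cross_term_ge_le [IsProbabilityMeasure μ] {η₁ : T₁ → Ω → ℝ} {η₂ : T₂ → Ω → ℝ}
    (hind : iIndepFun (Sum.elim η₁ η₂) μ) {c₁ : T₁ → NNReal} {c₂ : T₂ → NNReal}
    (h₁ : ∀ t, HasSubgaussianMGF (η₁ t) (c₁ t) μ) (h₂ : ∀ t, HasSubgaussianMGF (η₂ t) (c₂ t) μ)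
    {V R l D : ℝ} (hV : 0 < V) (hvV : ∀ t, (c₂ t : ℝ) ≤ V) (hR : 0 < R) (hl : 0 ≤ l) (hD : 0 < D)
    (b : I → T₁ → ℝ) (ξ : T₂ → I) {a : T₂ → ℝ} (ha : ∑ t, a t ^ 2 ≤ R) :
    μ.real {ω | (∀ x, |∑ s, b x s * η₁ s ω| < √D) ∧
      √(10 * l * (V * (4 * D * R))) ≤ |∑ t, (2 * a t * ∑ s, b (ξ t) s * η₁ s ω) * η₂ t ω|} ≤
      2 * Real.exp (-5 * l) := by
  have hm₁ := fun t => (h₁ t).aemeasurable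
  have hm₂ := fun t => (h₂ t).aemeasurable
  have hind₂ : iIndepFun η₂ μ := hind.precomp (g := Sum.inr) Sum.inr_injective
  refine measureReal_prodMk_mem_le (Y := fun ω t => η₁ t ω) (Z := fun ω t => η₂ t ω)
    (G := {p | (∀ x, |∑ s, b x s * p.1 s| < √D) ∧
      √(10 * l * (V * (4 * D * R))) ≤ |∑ t, (2 * a t * ∑ s, b (ξ t) s * p.1 s) * p.2 t|})
    (aemeasurable_pi_lambda _ hm₁) (aemeasurable_pi_lambda _ hm₂)
    (indepFun_of_iIndepFun_sumElim hind hm₁ hm₂) ?_ fun y => ?_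
  · have hf : ∀ x, Measurable fun p : (T₁ → ℝ) × (T₂ → ℝ) => |∑ s, b x s * p.1 s| := fun x =>
      Measurable.abs (f := fun p : (T₁ → ℝ) × (T₂ → ℝ) => ∑ s, b x s * p.1 s) (by fun_prop)
    have hg : Measurable fun p : (T₁ → ℝ) × (T₂ → ℝ) =>
        |∑ t, (2 * a t * ∑ s, b (ξ t) s * p.1 s) * p.2 t| :=
      Measurable.abs (f := fun p : (T₁ → ℝ) × (T₂ → ℝ) =>
        ∑ t, (2 * a t * ∑ s, b (ξ t) s * p.1 s) * p.2 t) (by fun_prop)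
    have hall : MeasurableSet {p : (T₁ → ℝ) × (T₂ → ℝ) | ∀ x, |∑ s, b x s * p.1 s| < √D} := by
      rw [Set.ofPred_forall]
      exact MeasurableSet.iInter fun x => measurableSet_lt (hf x) measurable_const
    exact hall.inter (measurableSet_le measurable_const hg)
  -- With the first stage frozen at y, accuracy bounds the squared coefficients by 4D·a_t², and the
  -- cross term is an ordinary sub-Gaussian sum. If y is inaccurate the slice is empty, since
  -- accuracy is part of the event.
  · by_cases hy : ∀ x, |∑ s, b x s * y s| < √D
    · have hb : ∑ t, (2 * a t * ∑ s, b (ξ t) s * y s) ^ 2 ≤ 4 * D * R := by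
        calc _ ≤ ∑ t, 4 * D * a t ^ 2 := by
              refine Finset.sum_le_sum fun t _ => ?_
              have h3 : (∑ s, b (ξ t) s * y s) ^ 2 ≤ D := by
                have h := pow_le_pow_left₀ (abs_nonneg _) (hy (ξ t)).le 2
                rwa [sq_abs, Real.sq_sqrt hD.le] at h
              calc _ = 4 * (∑ s, b (ξ t) s * y s) ^ 2 * a t ^ 2 := by ring
                _ ≤ _ := by gcongr
          _ ≤ 4 * D * R := by rw [← Finset.mul_sum]; gcongr
      refine (measureReal_mono ?_).trans
        (measureReal_abs_sum_ge_le hind₂ h₂ hV hvV (R := 4 * D * R) (by positivity) hl hb)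
      exact fun ω hω => hω.2
    · have : {ω | (y, fun t => η₂ t ω) ∈ {p : (T₁ → ℝ) × (T₂ → ℝ) |
          (∀ x, |∑ s, b x s * p.1 s| < √D) ∧ √(10 * l * (V * (4 * D * R))) ≤
            |∑ t, (2 * a t * ∑ s, b (ξ t) s * p.1 s) * p.2 t|}} = ∅ :=
        Set.eq_empty_of_forall_notMem fun ω hω => hy hω.1
      rw [this, measureReal_empty]
      positivity

/-- Three events per arm, each of probability at most 2·exp(−5l): inaccurate first stage, large
cross term while the first stage is accurate, large quadratic term. Outside them the error is at
most 28V√(lR) + 2D + D, and D = 10lVR ≤ 10V√(lR) because lR ≤ 1; hence 58. -/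
theorem measureReal_two_stage_error_le [IsProbabilityMeasure μ] {η₁ : T₁ → Ω → ℝ}
    {η₂ : T₂ → Ω → ℝ} (hind : iIndepFun (Sum.elim η₁ η₂) μ) {v₁ : T₁ → ℝ} {v₂ : T₂ → ℝ}
    (h₁ : ∀ t, IsStrictlySubGaussian (η₁ t) (v₁ t) μ)
    (h₂ : ∀ t, IsStrictlySubGaussian (η₂ t) (v₂ t) μ) {V R l : ℝ} (hV : 0 < V)
    (hv₂ : ∀ t, 0 < v₂ t) (hvV₁ : ∀ t, v₁ t ≤ V) (hvV₂ : ∀ t, v₂ t ≤ V) (hR : 0 < R)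
    (hl : 0 < l) (hlR : l * R ≤ 1) {a : I → T₂ → ℝ} {b : I → T₁ → ℝ} (ξ : T₂ → I)
    (hb : ∀ x, ∑ s, b x s ^ 2 ≤ R) (ha : ∀ x, ∑ t, a x t ^ 2 ≤ R) (ha' : ∀ x t, |a x t| ≤ R) :
    μ.real {ω | ∃ x, 58 * V * √(l * R) < |∑ t, a x t * (η₂ t ω ^ 2 - v₂ t)
      - ∑ t, (2 * a x t * ∑ s, b (ξ t) s * η₁ s ω) * η₂ t ω + (∑ s, b x s * η₁ s ω) ^ 2|} ≤
      Fintype.card I * (6 * Real.exp (-5 * l)) := by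
  set D := 10 * l * (V * R) with hDdef
  have hD : 0 < D := by positivity
  have hsub₁ : ∀ t, ((v₁ t).toNNReal : ℝ) ≤ V := fun t => by
    rw [Real.coe_toNNReal']
    exact max_le (hvV₁ t) hV.le
  have hsub₂ : ∀ t, ((v₂ t).toNNReal : ℝ) ≤ V := fun t => by
    rw [Real.coe_toNNReal']
    exact max_le (hvV₂ t) hV.le
  have hind₁ : iIndepFun η₁ μ := hind.precomp (g := Sum.inl) Sum.inl_injective
  have hind₂ : iIndepFun η₂ μ := hind.precomp (g := Sum.inr) Sum.inr_injective
  set E₁ : I → Set Ω := fun x => {ω | √D ≤ |∑ s, b x s * η₁ s ω|}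
  set E₂ : I → Set Ω := fun x => {ω | (∀ x, |∑ s, b x s * η₁ s ω| < √D) ∧
      √(10 * l * (V * (4 * D * R))) ≤ |∑ t, (2 * a x t * ∑ s, b (ξ t) s * η₁ s ω) * η₂ t ω|}
  set E₃ : I → Set Ω := fun x => {ω | 28 * V * √(l * R) ≤ |∑ t, a x t * (η₂ t ω ^ 2 - v₂ t)|}
  have hE₁ : ∀ x, μ.real (E₁ x) ≤ 2 * Real.exp (-5 * l) := fun x =>
    measureReal_abs_sum_ge_le hind₁ (fun t => (h₁ t).1) hV hsub₁ hR hl.le (hb x)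
  have hE₂ : ∀ x, μ.real (E₂ x) ≤ 2 * Real.exp (-5 * l) := fun x =>
    measureReal_cross_term_ge_le hind (fun t => (h₁ t).1) (fun t => (h₂ t).1) hV hsub₂ hR hl.le hD
      b ξ (ha x)
  have hE₃ : ∀ x, μ.real (E₃ x) ≤ 2 * Real.exp (-5 * l) := fun x =>
    measureReal_abs_sum_sq_sub_ge_le hind₂ h₂ hv₂ hV hvV₂ hR hl.le (ha x) (ha' x) hlR
  have hsq : √(10 * l * (V * (4 * D * R))) = 2 * D := by
    rw [show 10 * l * (V * (4 * D * R)) = (2 * D) ^ 2 by rw [hDdef]; ring]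
    exact Real.sqrt_sq (by positivity)
  have hlR0 : 0 ≤ l * R := by positivity
  have hD' : D ≤ 10 * V * √(l * R) := by
    have : l * R ≤ √(l * R) := by
      refine Real.le_sqrt_of_sq_le ?_
      nlinarith
    calc D = 10 * V * (l * R) := by rw [hDdef]; ring
      _ ≤ _ := by gcongr
  calc _ ≤ μ.real (⋃ x, (E₁ x ∪ E₂ x ∪ E₃ x)) := by
        refine measureReal_mono ?_
        rintro ω ⟨x, hx⟩
        by_contra hω
        simp only [Set.mem_iUnion, Set.mem_union, not_exists, not_or] at hω
        have hω₁ : ∀ x, |∑ s, b x s * η₁ s ω| < √D := fun x => not_le.1 (hω x).1.1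
        have hω₂ : |∑ t, (2 * a x t * ∑ s, b (ξ t) s * η₁ s ω) * η₂ t ω| < 2 * D := by
          rw [← hsq]
          exact not_le.1 fun h => (hω x).1.2 ⟨hω₁, h⟩
        have hω₃ : |∑ t, a x t * (η₂ t ω ^ 2 - v₂ t)| < 28 * V * √(l * R) := not_le.1 (hω x).2
        have hω₄ : (∑ s, b x s * η₁ s ω) ^ 2 ≤ D := by
          have h := pow_le_pow_left₀ (abs_nonneg _) (hω₁ x).le 2
          rwa [sq_abs, Real.sq_sqrt hD.le] at h
        have h1 := abs_add_le (∑ t, a x t * (η₂ t ω ^ 2 - v₂ t)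
          - ∑ t, (2 * a x t * ∑ s, b (ξ t) s * η₁ s ω) * η₂ t ω) ((∑ s, b x s * η₁ s ω) ^ 2)
        have h2 := abs_sub (∑ t, a x t * (η₂ t ω ^ 2 - v₂ t))
          (∑ t, (2 * a x t * ∑ s, b (ξ t) s * η₁ s ω) * η₂ t ω)
        rw [abs_of_nonneg (sq_nonneg (∑ s, b x s * η₁ s ω))] at h1
        linarith
    _ ≤ ∑ x, μ.real (E₁ x ∪ E₂ x ∪ E₃ x) := measureReal_iUnion_fintype_le _
    _ ≤ ∑ _ : I, 6 * Real.exp (-5 * l) := by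
        refine Finset.sum_le_sum fun x _ => ?_
        have h1 := measureReal_union_le (μ := μ) (E₁ x ∪ E₂ x) (E₃ x)
        have h2 := measureReal_union_le (μ := μ) (E₁ x) (E₂ x)
        linarith [hE₁ x, hE₂ x, hE₃ x]
    _ = _ := by simp

end TwoStage

/-! ### Least squares weights. -/

section LeastSquares

variable {T κ : Type*} [Fintype T] [Fintype κ] [DecidableEq κ]

theorem dotProduct_leastSquares (g : T → κ → ℝ) (y : T → ℝ) (u : κ → ℝ) :
    u ⬝ᵥ leastSquares g y =
      ∑ t, (u ⬝ᵥ ((∑ t, vecMulVec (g t) (g t))⁻¹ *ᵥ g t)) * y t := by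
  simp only [leastSquares, mulVec_sum, dotProduct_sum, mulVec_smul, dotProduct_smul, smul_eq_mul,
    mul_comm]

/-- Least squares recovers an exactly linear response without error. This removes the true
parameters in both stages and carries the squared bias through the second. -/
theorem sum_weight_mul_dotProduct {g : T → κ → ℝ}
    (hA : IsUnit (∑ t, vecMulVec (g t) (g t)).det) (u z : κ → ℝ) :
    ∑ t, (u ⬝ᵥ ((∑ t, vecMulVec (g t) (g t))⁻¹ *ᵥ g t)) * (g t ⬝ᵥ z) = u ⬝ᵥ z := by
  rw [← dotProduct_leastSquares, leastSquares]
  have : ∑ t, (g t ⬝ᵥ z) • g t = (∑ t, vecMulVec (g t) (g t)) *ᵥ z := by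
    rw [sum_mulVec]
    refine Finset.sum_congr rfl fun t _ => ?_
    rw [vecMulVec_mulVec, op_smul_eq_smul]
  rw [this, mulVec_mulVec, nonsing_inv_mul _ hA, one_mulVec]

theorem dotProduct_inv_mulVec_comm {A : Matrix κ κ ℝ} (hA : A.IsHermitian) (u z : κ → ℝ) :
    u ⬝ᵥ (A⁻¹ *ᵥ z) = z ⬝ᵥ (A⁻¹ *ᵥ u) := by
  have h : (A⁻¹)ᵀ = A⁻¹ := by simpa using hA.inv.eq
  rw [dotProduct_mulVec, ← mulVec_transpose, h, dotProduct_comm]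

/-- The reproduction identity at z = A⁻¹u, with A⁻¹ symmetric. It converts the design bound into a
bound on the sum of squared weights. -/
theorem sum_weight_sq {g : T → κ → ℝ} (hA : (∑ t, vecMulVec (g t) (g t)).PosDef) (u : κ → ℝ) :
    ∑ t, (u ⬝ᵥ ((∑ t, vecMulVec (g t) (g t))⁻¹ *ᵥ g t)) ^ 2 =
      u ⬝ᵥ ((∑ t, vecMulVec (g t) (g t))⁻¹ *ᵥ u) := by
  rw [← sum_weight_mul_dotProduct (isUnit_det_of_posDef hA) u
    ((∑ t, vecMulVec (g t) (g t))⁻¹ *ᵥ u)]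
  refine Finset.sum_congr rfl fun t _ => ?_
  rw [pow_two, dotProduct_inv_mulVec_comm hA.1 (g t) u]

/-- Nonnegativity of the form at u + z and u − z. It gives the uniform bound on single weights that
the Bernstein estimate needs. -/
theorem abs_dotProduct_inv_mulVec_le {A : Matrix κ κ ℝ} (hA : A.PosDef) {u z : κ → ℝ} {R : ℝ}
    (hu : u ⬝ᵥ (A⁻¹ *ᵥ u) ≤ R) (hz : z ⬝ᵥ (A⁻¹ *ᵥ z) ≤ R) : |u ⬝ᵥ (A⁻¹ *ᵥ z)| ≤ R := by
  have h1 := dotProduct_inv_mulVec_nonneg hA (u + z)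
  have h2 := dotProduct_inv_mulVec_nonneg hA (u - z)
  simp only [mulVec_add, mulVec_sub, dotProduct_add, dotProduct_sub, add_dotProduct,
    sub_dotProduct] at h1 h2
  rw [dotProduct_inv_mulVec_comm hA.1 z u] at h1 h2
  exact abs_le.2 ⟨by linarith, by linarith⟩

end LeastSquares

/-! ### Lifted features, the error decomposition and clipping. -/

section Lifting

variable {d : ℕ}

theorem phi_dotProduct_vech {A : Matrix (Fin d) (Fin d) ℝ} (hA : A.IsSymm) (x : Fin d → ℝ) :
    phi x ⬝ᵥ vech A = armVar A x := by
  rw [phi, ← dotProduct_mulVec, dupMatrix_mulVec_vech A hA]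
  simp only [armVar, dotProduct, mulVec, Fintype.sum_prod_type, vec, vecMulVec_apply,
    Finset.mul_sum]
  rw [Finset.sum_comm]
  exact Finset.sum_congr rfl fun i _ => Finset.sum_congr rfl fun j _ => by ring

theorem armVar_unvech (s : HalfIdx d → ℝ) (x : Fin d → ℝ) : armVar (unvech s) x = phi x ⬝ᵥ s := by
  rw [← phi_dotProduct_vech (unvech_isSymm s), vech_unvech]

theorem phi_dotProduct_vech_vecMulVec (x u : Fin d → ℝ) :
    phi x ⬝ᵥ vech (vecMulVec u u) = (x ⬝ᵥ u) ^ 2 := by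
  rw [phi_dotProduct_vech (transpose_vecMulVec u u), armVar, vecMulVec_mulVec, op_smul_eq_smul,
    dotProduct_smul, smul_eq_mul, dotProduct_comm u, pow_two]

variable {X : Finset (Fin d → ℝ)}

theorem eq_zero_of_features_dotProduct_eq_zero
    (hX : Submodule.span ℝ (phi '' (X : Set (Fin d → ℝ))) = ⊤) (u : HalfIdx d → ℝ)
    (hu : ∀ i, features X i ⬝ᵥ u = 0) : u = 0 := by
  have h : ∀ z ∈ Submodule.span ℝ (phi '' (X : Set (Fin d → ℝ))), z ⬝ᵥ u = 0 := fun z hz => by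
    induction hz using Submodule.span_induction with
    | mem z hz =>
      obtain ⟨x, hx, rfl⟩ := hz
      exact hu ⟨x, hx⟩
    | zero => exact zero_dotProduct u
    | add y z _ _ hy hz => rw [add_dotProduct, hy, hz, add_zero]
    | smul c z _ hz => rw [smul_dotProduct, hz, smul_zero]
  exact dotProduct_self_eq_zero.1 (h u (hX ▸ Submodule.mem_top))

/-- A vector u orthogonal to all arms makes vech(uuᵀ) orthogonal to all features, so uuᵀ = 0, and
its diagonal holds the u_i². -/
theorem eq_zero_of_arms_dotProduct_eq_zero
    (hX : Submodule.span ℝ (phi '' (X : Set (Fin d → ℝ))) = ⊤) (u : Fin d → ℝ)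
    (hu : ∀ i, arms X i ⬝ᵥ u = 0) : u = 0 := by
  have h := eq_zero_of_features_dotProduct_eq_zero hX (vech (vecMulVec u u)) fun i => by
    rw [features, phi_dotProduct_vech_vecMulVec]
    simpa [arms] using hu i
  ext i
  have h1 := congrFun h ⟨(i, i), le_rfl⟩
  simpa [vech, vecMulVec_apply] using h1

theorem card_halfIdx_le (d : ℕ) : Fintype.card (HalfIdx d) ≤ d ^ 2 := by
  refine (Fintype.card_subtype_le _).trans ?_
  simp [pow_two]

theorem sum_pull_vecMulVec {κ : Type*} (n : X → ℕ) (f : X → κ → ℝ) :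
    ∑ t : Pull n, vecMulVec (f t.1) (f t.1) = infoMatrix f fun i => (n i : ℝ) := by
  rw [infoMatrix, Fintype.sum_sigma]
  simp [Nat.cast_smul_eq_nsmul]

variable {n₁ n₂ : X → ℕ}

theorem dotProduct_thetaHat_sub
    (hA : IsUnit (∑ t : Pull n₁, vecMulVec t.1.1 t.1.1).det) (θ : Fin d → ℝ) (η : Pull n₁ → ℝ)
    (x : Fin d → ℝ) :
    x ⬝ᵥ (thetaHat (response θ η) - θ) =
      ∑ t : Pull n₁, (x ⬝ᵥ ((∑ t : Pull n₁, vecMulVec t.1.1 t.1.1)⁻¹ *ᵥ t.1.1)) * η t := by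
  rw [dotProduct_sub, thetaHat, dotProduct_leastSquares]
  simp only [response, mul_add, Finset.sum_add_distrib]
  rw [sum_weight_mul_dotProduct hA, add_sub_cancel_left]

/-- The exact error of the unclipped variance estimate. The squared bias of the first stage is
itself linear in the lifted features, so it passes through the second regression unchanged. -/
theorem armVar_sigmaHat_sub
    (hA : IsUnit (∑ t : Pull n₂, vecMulVec (phi t.1.1) (phi t.1.1)).det)
    {S : Matrix (Fin d) (Fin d) ℝ} (hS : S.IsSymm) (θ : Fin d → ℝ) (y₁ : Pull n₁ → ℝ)
    (η : Pull n₂ → ℝ) (x : Fin d → ℝ) {a : Pull n₂ → ℝ}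
    (ha : ∀ t, a t = phi x ⬝ᵥ
      ((∑ t : Pull n₂, vecMulVec (phi t.1.1) (phi t.1.1))⁻¹ *ᵥ phi t.1.1)) :
    armVar (sigmaHat y₁ (response θ η)) x - armVar S x =
      ∑ t, a t * (η t ^ 2 - armVar S t.1.1)
        - ∑ t, (2 * a t * (t.1.1 ⬝ᵥ (thetaHat y₁ - θ))) * η t
        + (x ⬝ᵥ (thetaHat y₁ - θ)) ^ 2 := by
  have h1 := sum_weight_mul_dotProduct hA (phi x) (vech S)
  have h2 := sum_weight_mul_dotProduct hA (phi x)
    (vech (vecMulVec (thetaHat y₁ - θ) (thetaHat y₁ - θ)))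
  simp only [phi_dotProduct_vech_vecMulVec, phi_dotProduct_vech hS, ← ha] at h1 h2
  rw [sigmaHat, armVar_unvech, dotProduct_leastSquares, ← h1, ← h2, ← Finset.sum_sub_distrib,
    ← Finset.sum_sub_distrib, ← Finset.sum_add_distrib]
  refine Finset.sum_congr rfl fun t _ => ?_
  rw [← ha, response, dotProduct_sub]
  ring

/-- Clipping is the projection onto an interval that contains s. -/
theorem abs_clip_sub_le {m M s y : ℝ} (hm : m ≤ s) (hM : s ≤ M) :
    |min (max y m) M - s| ≤ |y - s| := by
  rw [abs_le]
  constructor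
  · have h := neg_abs_le (y - s)
    rcases le_total y s with hy | hy
    · have : y ≤ min (max y m) M := le_min (le_max_left _ _) (hy.trans hM)
      linarith
    · have : s ≤ min (max y m) M := le_min (hy.trans (le_max_left _ _)) hM
      linarith [abs_nonneg (y - s)]
  · have h := le_abs_self (y - s)
    rcases le_total y s with hy | hy
    · have : min (max y m) M ≤ s := (min_le_left _ _).trans (max_le hy hm)
      linarith [abs_nonneg (y - s)]
    · have : min (max y m) M ≤ y := (min_le_left _ _).trans (max_le le_rfl (hm.trans hy))
      linarith

theorem abs_clip_sub_le_sub {m M s y : ℝ} (hm : m ≤ s) (hM : s ≤ M) :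
    |min (max y m) M - s| ≤ M - m := by
  have h1 : m ≤ min (max y m) M := le_min (le_max_right _ _) (hm.trans hM)
  have h2 : min (max y m) M ≤ M := min_le_right _ _
  exact abs_le.2 ⟨by linarith, by linarith⟩

end Lifting

/-! ### Assembly of the bounds and the main theorem. -/

/-- The left side is 6δ(δ/n)⁴ ≤ 6δ/16. For n = 1 this fails as δ approaches 1, so a single arm is
treated apart. -/
theorem card_mul_exp_le {n : ℕ} (hn : 2 ≤ n) {δ : ℝ} (hδ : 0 < δ) (hδ' : δ < 1) :
    (n : ℝ) * (6 * Real.exp (-5 * Real.log (n / δ))) ≤ δ / 2 := by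
  have hn' : (2 : ℝ) ≤ n := by exact_mod_cast hn
  have hn0 : (0 : ℝ) < n := by linarith
  have h1 : Real.exp (-5 * Real.log (n / δ)) = (δ / n) ^ 5 := by
    rw [show -5 * Real.log (n / δ) = (5 : ℕ) * Real.log (δ / n) by
      rw [← inv_div, Real.log_inv]; push_cast; ring, Real.exp_nat_mul,
      Real.exp_log (by positivity)]
  have h2 : (δ / n) ^ 4 ≤ (1 / 2) ^ 4 := by
    gcongr
  calc (n : ℝ) * (6 * Real.exp (-5 * Real.log (n / δ))) = 6 * δ * (δ / n) ^ 4 := by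
        rw [h1]; field_simp
    _ ≤ 6 * δ * (1 / 2) ^ 4 := by gcongr
    _ ≤ δ / 2 := by linarith

theorem nonempty_of_span_phi {d : ℕ} (hd : 0 < d) {X : Finset (Fin d → ℝ)}
    (hX : Submodule.span ℝ (phi '' (X : Set (Fin d → ℝ))) = ⊤) : Nonempty X := by
  by_contra h
  rw [not_nonempty_iff] at h
  have := congrFun (eq_zero_of_arms_dotProduct_eq_zero hX (fun _ => 1) fun i => h.elim i) ⟨0, hd⟩
  simp at this

theorem measureReal_varHat_error_le {d : ℕ} {X : Finset (Fin d → ℝ)} {n₁ n₂ : X → ℕ}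
    (hA₁ : (infoMatrix (arms X) fun i => (n₁ i : ℝ)).PosDef)
    (hA₂ : (infoMatrix (features X) fun i => (n₂ i : ℝ)).PosDef) {R l : ℝ} (hR : 0 < R)
    (hl : 0 < l) (hlR : l * R ≤ 1)
    (hR₁ : ∀ i, arms X i ⬝ᵥ ((infoMatrix (arms X) fun i => (n₁ i : ℝ))⁻¹ *ᵥ arms X i) ≤ R)
    (hR₂ : ∀ i, features X i ⬝ᵥ
      ((infoMatrix (features X) fun i => (n₂ i : ℝ))⁻¹ *ᵥ features X i) ≤ R)
    (θ : Fin d → ℝ) {S : Matrix (Fin d) (Fin d) ℝ} (hS : S.IsSymm) {σmin σmax : ℝ}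
    (hσ : 0 < σmin) (hσ' : 0 < σmax)
    (hvar : ∀ x ∈ X, σmin ^ 2 ≤ armVar S x ∧ armVar S x ≤ σmax ^ 2)
    {Ω : Type*} [MeasurableSpace Ω] {μ : Measure Ω} [IsProbabilityMeasure μ]
    {η₁ : Pull n₁ → Ω → ℝ} {η₂ : Pull n₂ → Ω → ℝ} (hind : iIndepFun (Sum.elim η₁ η₂) μ)
    (h₁ : ∀ t, IsStrictlySubGaussian (η₁ t) (armVar S t.1.1) μ)
    (h₂ : ∀ t, IsStrictlySubGaussian (η₂ t) (armVar S t.1.1) μ) :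
    μ.real {ω | ∀ x ∈ X, |varHat σmin σmax (response θ fun t => η₁ t ω)
      (response θ fun t => η₂ t ω) x - armVar S x| ≤ 58 * σmax ^ 2 * √(l * R)}ᶜ ≤
      X.card * (6 * Real.exp (-5 * l)) := by
  have e₁ : ∑ t : Pull n₁, vecMulVec t.1.1 t.1.1 = infoMatrix (arms X) fun i => (n₁ i : ℝ) :=
    sum_pull_vecMulVec n₁ (arms X)
  have e₂ : ∑ t : Pull n₂, vecMulVec (phi t.1.1) (phi t.1.1) =
      infoMatrix (features X) fun i => (n₂ i : ℝ) := sum_pull_vecMulVec n₂ (features X)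
  rw [← e₁] at hA₁ hR₁
  rw [← e₂] at hA₂ hR₂
  have hmain := measureReal_two_stage_error_le (I := X) hind h₁ h₂ (V := σmax ^ 2) (by positivity)
    (fun t => (pow_pos hσ 2).trans_le (hvar _ t.1.2).1) (fun t => (hvar _ t.1.2).2)
    (fun t => (hvar _ t.1.2).2) hR hl hlR
    (a := fun x t => phi x.1 ⬝ᵥ
      ((∑ t : Pull n₂, vecMulVec (phi t.1.1) (phi t.1.1))⁻¹ *ᵥ phi t.1.1))
    (b := fun x t => x.1 ⬝ᵥ ((∑ t : Pull n₁, vecMulVec t.1.1 t.1.1)⁻¹ *ᵥ t.1.1))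
    (fun t => t.1)
    (fun x => (sum_weight_sq hA₁ x.1).trans_le (hR₁ x))
    (fun x => (sum_weight_sq hA₂ (phi x.1)).trans_le (hR₂ x))
    (fun x t => abs_dotProduct_inv_mulVec_le hA₂ (hR₂ x) (hR₂ t.1))
  rw [Fintype.card_coe] at hmain
  refine (measureReal_mono ?_).trans hmain
  intro ω hω
  simp only [Set.mem_compl_iff, Set.mem_ofPred_eq, not_forall, not_le] at hω
  obtain ⟨x, hx, hlt⟩ := hω
  refine ⟨⟨x, hx⟩, hlt.trans_le ((abs_clip_sub_le (hvar x hx).1 (hvar x hx).2).trans ?_)⟩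
  rw [armVar_sigmaHat_sub (isUnit_det_of_posDef hA₂) hS θ _ _ x fun _ => rfl]
  simp only [dotProduct_thetaHat_sub (isUnit_det_of_posDef hA₁)]
  exact le_rfl

end HEAD

theorem theorem1 :
    ∃ C : ℝ, 0 < C ∧ ∀ ε : ℝ, 0 < ε → ε ≤ 1 / 3 → ∃ c : ℝ, 0 < c ∧
      ∀ (d : ℕ) (_ : 0 < d) (X : Finset (Fin d → ℝ))
        (_ : Submodule.span ℝ (HEAD.phi '' (X : Set (Fin d → ℝ))) = ⊤)
        (θ : Fin d → ℝ) (S : Matrix (Fin d) (Fin d) ℝ) (_ : S.PosSemidef)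
        (σmin σmax : ℝ) (_ : 0 < σmin) (_ : 0 < σmax)
        (_ : ∀ x ∈ X, σmin ^ 2 ≤ HEAD.armVar S x ∧ HEAD.armVar S x ≤ σmax ^ 2)
        (_ : X.card = 1 → σmin = σmax)
        (δ : ℝ) (_ : 0 < δ) (_ : δ < 1) (Γ : ℕ)
        (_ : c * max (σmax ^ 2 * Real.log (X.card / δ) * (d : ℝ) ^ 2) ((d : ℝ) ^ 2) ≤ Γ),
        -- the procedure can be run within the budget
        (∃ (w₁ w₂ : X → ℝ) (n₁ n₂ : X → ℕ),
          HEAD.IsGOptimal (HEAD.arms X) w₁ ∧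
          HEAD.IsEfficientRounding (HEAD.arms X) ε ((Γ : ℝ) / 2) w₁ n₁ ∧
          HEAD.IsGOptimal (HEAD.features X) w₂ ∧
          HEAD.IsEfficientRounding (HEAD.features X) ε ((Γ : ℝ) / 2) w₂ n₂) ∧
        -- and every run of it satisfies the error bound
        ∀ (w₁ w₂ : X → ℝ) (n₁ n₂ : X → ℕ),
          HEAD.IsGOptimal (HEAD.arms X) w₁ →
          HEAD.IsAllocation (HEAD.arms X) ε ((Γ : ℝ) / 2) w₁ n₁ →
          HEAD.IsGOptimal (HEAD.features X) w₂ →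
          HEAD.IsAllocation (HEAD.features X) ε ((Γ : ℝ) / 2) w₂ n₂ →
          ∀ (Ω : Type*) [MeasurableSpace Ω] (μ : Measure Ω) [IsProbabilityMeasure μ]
            (η₁ : HEAD.Pull n₁ → Ω → ℝ) (η₂ : HEAD.Pull n₂ → Ω → ℝ),
            iIndepFun (Sum.elim η₁ η₂) μ →
            (∀ t, HEAD.IsStrictlySubGaussian (η₁ t) (HEAD.armVar S t.1.1) μ) →
            (∀ t, HEAD.IsStrictlySubGaussian (η₂ t) (HEAD.armVar S t.1.1) μ) →
            1 - δ / 2 ≤ μ.real {ω | ∀ x ∈ X,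
              |HEAD.varHat σmin σmax (HEAD.response θ fun t => η₁ t ω)
                  (HEAD.response θ fun t => η₂ t ω) x - HEAD.armVar S x| ≤
                √(C * Real.log (X.card / δ) * σmax ^ 4 * (d : ℝ) ^ 2 / Γ)} := by
  -- 20184 = 58²·6, from the error 58V√(lR) with R = 6d²/Γ. The constant 4/ε² turns Γ ≥ c·d² into
  -- the condition 2M/ε² ≤ Γ/2 of the rounding lemma, for every M ≤ d².
  refine ⟨20184, by norm_num, fun ε hε hε' => ⟨4 / ε ^ 2, by positivity, ?_⟩⟩
  intro d hd X hX θ S hS σmin σmax hσ hσ' hvar hcard δ hδ hδ' Γ hΓ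
  have hXn : Nonempty X := HEAD.nonempty_of_span_phi hd hX
  have hdn : Nonempty (Fin d) := ⟨⟨0, hd⟩⟩
  have hHn : Nonempty (HEAD.HalfIdx d) := ⟨⟨(⟨0, hd⟩, ⟨0, hd⟩), le_rfl⟩⟩
  have harms := HEAD.eq_zero_of_arms_dotProduct_eq_zero hX
  have hfeat := HEAD.eq_zero_of_features_dotProduct_eq_zero hX
  have hd1 : (1 : ℝ) ≤ d := by exact_mod_cast hd
  have hΓd : 4 / ε ^ 2 * (d : ℝ) ^ 2 ≤ Γ :=
    (mul_le_mul_of_nonneg_left (le_max_right _ _) (by positivity)).trans hΓ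
  have hΓ0 : (0 : ℝ) < Γ := lt_of_lt_of_le (by positivity) hΓd
  have hM₁ : (Fintype.card (Fin d) : ℝ) ≤ (d : ℝ) ^ 2 := by
    rw [Fintype.card_fin]
    nlinarith
  have hM₂ : (Fintype.card (HEAD.HalfIdx d) : ℝ) ≤ (d : ℝ) ^ 2 := by
    exact_mod_cast HEAD.card_halfIdx_le d
  have hround : ∀ {M : ℝ}, M ≤ (d : ℝ) ^ 2 → 2 * M / ε ^ 2 ≤ (Γ : ℝ) / 2 := fun {M} hM => by
    calc 2 * M / ε ^ 2 ≤ 2 * (d : ℝ) ^ 2 / ε ^ 2 := by gcongr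
      _ = 4 / ε ^ 2 * (d : ℝ) ^ 2 / 2 := by ring
      _ ≤ Γ / 2 := by gcongr
  refine ⟨?_, ?_⟩
  · obtain ⟨w₁, hw₁⟩ := HEAD.exists_isGOptimal harms
    obtain ⟨w₂, hw₂⟩ := HEAD.exists_isGOptimal hfeat
    obtain ⟨n₁, hn₁⟩ := HEAD.exists_isEfficientRounding hw₁ hε hε' (hround hM₁)
    obtain ⟨n₂, hn₂⟩ := HEAD.exists_isEfficientRounding hw₂ hε hε' (hround hM₂)
    exact ⟨w₁, w₂, n₁, n₂, hw₁, hn₁, hw₂, hn₂⟩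
  intro w₁ w₂ n₁ n₂ hw₁ hn₁ hw₂ hn₂ Ω _ μ _ η₁ η₂ hind h₁ h₂
  set L := Real.log (X.card / δ) with hL
  set q := (d : ℝ) ^ 2 * L / Γ with hq
  have hrad : √(20184 * L * σmax ^ 4 * (d : ℝ) ^ 2 / Γ) = σmax ^ 2 * √(20184 * q) := by
    rw [show 20184 * L * σmax ^ 4 * (d : ℝ) ^ 2 / Γ = (σmax ^ 2) ^ 2 * (20184 * q) by
      rw [hq]; ring, Real.sqrt_mul (by positivity), Real.sqrt_sq (by positivity)]
  rw [hrad]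
  -- Clipping alone settles two regimes, for every outcome: a single arm, where the interval is a
  -- point, and 20184q ≥ 1, where the radius is at least σmax². Otherwise lR = 6q ≤ 1.
  have htriv : (∀ x ∈ X, ∀ y : ℝ, |min (max y (σmin ^ 2)) (σmax ^ 2) - HEAD.armVar S x| ≤
      σmax ^ 2 * √(20184 * q)) → 1 - δ / 2 ≤ μ.real {ω | ∀ x ∈ X,
        |HEAD.varHat σmin σmax (HEAD.response θ fun t => η₁ t ω)
          (HEAD.response θ fun t => η₂ t ω) x - HEAD.armVar S x| ≤ σmax ^ 2 * √(20184 * q)} := by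
    intro h
    have huniv : {ω | ∀ x ∈ X, |HEAD.varHat σmin σmax (HEAD.response θ fun t => η₁ t ω)
        (HEAD.response θ fun t => η₂ t ω) x - HEAD.armVar S x| ≤ σmax ^ 2 * √(20184 * q)} =
        Set.univ := Set.eq_univ_of_forall fun ω x hx => h x hx _
    rw [huniv, probReal_univ]
    linarith
  have hclip : ∀ x ∈ X, ∀ y : ℝ, |min (max y (σmin ^ 2)) (σmax ^ 2) - HEAD.armVar S x| ≤
      σmax ^ 2 - σmin ^ 2 := fun x hx y =>
    HEAD.abs_clip_sub_le_sub (hvar x hx).1 (hvar x hx).2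
  by_cases hX1 : X.card = 1
  · refine htriv fun x hx y => (hclip x hx y).trans ?_
    rw [hcard hX1, sub_self]
    positivity
  have hX2 : 2 ≤ X.card := by
    have : 0 < X.card := Finset.card_pos.2 (Finset.nonempty_coe_sort.1 hXn)
    omega
  by_cases hq1 : 1 ≤ 20184 * q
  · refine htriv fun x hx y => (hclip x hx y).trans ?_
    have h3 : σmax ^ 2 * 1 ≤ σmax ^ 2 * √(20184 * q) := by
      gcongr
      exact Real.one_le_sqrt.2 hq1
    have h4 : 0 < σmin ^ 2 := by positivity
    linarith
  have hL0 : 0 < L := by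
    refine Real.log_pos ?_
    rw [one_lt_div hδ]
    have : (2 : ℝ) ≤ X.card := by exact_mod_cast hX2
    linarith
  set R := 6 * (d : ℝ) ^ 2 / Γ with hR
  have hR0 : 0 < R := by positivity
  have hLR : L * R = 6 * q := by rw [hR, hq]; ring
  have hRle : ∀ {M : ℝ}, M ≤ (d : ℝ) ^ 2 → 3 * M / ((Γ : ℝ) / 2) ≤ R := fun {M} hM => by
    calc 3 * M / ((Γ : ℝ) / 2) = 6 * M / Γ := by field_simp; ring
      _ ≤ R := by rw [hR]; gcongr
  obtain ⟨hA₁, hb₁⟩ := hn₁.posDef_and_predVar_le hw₁ harms hε' (by positivity)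
  obtain ⟨hA₂, hb₂⟩ := hn₂.posDef_and_predVar_le hw₂ hfeat hε' (by positivity)
  have hbad := HEAD.measureReal_varHat_error_le hA₁ hA₂ hR0 hL0 (by rw [hLR]; linarith)
    (fun i => (hb₁ i).trans (hRle hM₁)) (fun i => (hb₂ i).trans (hRle hM₂)) θ
    (by simpa [Matrix.IsSymm] using hS.1.eq) hσ hσ' hvar hind h₁ h₂
  have hbad' := hbad.trans (HEAD.card_mul_exp_le hX2 hδ hδ')
  have hbound : 58 * σmax ^ 2 * √(L * R) = σmax ^ 2 * √(20184 * q) := by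
    rw [hLR, show 20184 * q = 58 ^ 2 * (6 * q) by ring, Real.sqrt_mul (by norm_num) (6 * q),
      Real.sqrt_sq (by norm_num)]
    ring
  rw [hbound] at hbad'
  set E := {ω | ∀ x ∈ X, |HEAD.varHat σmin σmax (HEAD.response θ fun t => η₁ t ω)
    (HEAD.response θ fun t => η₂ t ω) x - HEAD.armVar S x| ≤ σmax ^ 2 * √(20184 * q)}
  -- Subadditivity gives μ(E) ≥ 1 − μ(Eᶜ) without measurability of E.
  have hone := measureReal_union_le (μ := μ) E Eᶜ
  rw [Set.union_compl_self, probReal_univ] at hone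
  linarith
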